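/- Let $\mathbb F=\mathbb R$ or $\mathbb C$, let $m,n\ge 1$, and let $\underline d=(d_1,\dots,d_m)$ be a list of nonnegative integers, not all zero. Let $\mathbb F[\lambda]^{m\times(m+n)}_{\underline d}$ be the space of $m\times(m+n)$ polynomial matrices $M(\lambda)$ whose $i$th row has the form $R_i(\lambda)=\sum_{j=0}^{d_i}R_{i,j}\lambda^j$ with $R_{i,j}\in\mathbb F^{1\times(m+n)}$, $i=1,\dots,m$, with the distance $$\rho(M,\widetilde M)=\Big(\sum_{i=1}^m\sum_{j=0}^{d_i}\|R_{i,j}-\widetilde R_{i,j}\|_2^2\Big)^{1/2}.$$ The leading row-wise coefficient matrix of $M$ is the constant $m\times(m+n)$ matrix with rows $R_{1,d_1},\dots,R_{m,d_m}$. Let $d=\max_i d_i$ and write $M(\lambda)=\sum_{j=0}^d M_j\lambda^j$. For $k\ge1$, the $k$th Sylvester matrix $S_k(M)$ has $k+d$ block rows and $k$ block columns, and its block in position $(r,c)$ is $M_{r-c}$ if $0\le r-c\le d$ and $0$ otherwise. The $k$th trimmed Sylvester matrix $T_k(M)$, of size $(km+\sum_i d_i)\times k(m+n)$, is obtained from $S_k(M)$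 by removing, for each $i$, the last $d-d_i$ of the $k+d$ rows coming from the $i$th row of $M$ (these rows are zero). The matrix $M$ has full-trimmed-Sylvester-rank if $\operatorname{rank}T_k(M)=\min\{km+\sum_i d_i,\ k(m+n)\}$ for all $k\ge1$; let $\mathrm{TSyl}$ denote the set of all such matrices in $\mathbb F[\lambda]^{m\times(m+n)}_{\underline d}$. A minimal basis of a subspace $\mathcal V\subseteq\mathbb F(\lambda)^{m+n}$ is a basis of $\mathcal V$ consisting of polynomial vectors whose sum of degrees (the degree of a vector is the highest degree of its entries) is minimal among all such bases; the degrees of its vectors, counted with multiplicity, are the minimal indices of $\mathcal V$ and do not depend on the minimal basis. The matrix $M$ is called a minimal basis if its rows form a minimal basis of the subspace they span over $\mathbb F(\lambda)$, and its right minimal indices are the minimal indices of $\{x\in\mathbb F(\lambda)^{m+n}: M(\lambda)x=0\}$. Finally, let $k'=\lceil(\sum_{i=1}^m d_i)/n\rceil$ and $t=nk'-\sum_{i=1}^m d_i$, so that $0\le t<n$. (a) For every $M\in\mathbb F[\lambda]^{m\times(m+n)}_{\underline d}$ and every $\epsilon>0$ there exists $\widetilde M\in\mathrm{TSyl}$ with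 $\rho(M,\widetilde M)<\epsilon$. Moreover, every $\widetilde M\in\mathrm{TSyl}$ satisfies: (a1) $\widetilde M$ is a minimal basis, its leading row-wise coefficient matrix has full row rank $m$, and its row degrees are exactly $d_1,\dots,d_m$; (a2) $\widetilde M$ has exactly $n$ right minimal indices, $t$ of them equal to $k'-1$ and $n-t$ of them equal to $k'$. (b) For every $\widetilde M\in\mathrm{TSyl}$ there exists $\epsilon>0$ such that every $M\in\mathbb F[\lambda]^{m\times(m+n)}_{\underline d}$ with $\rho(M,\widetilde M)<\epsilon$ has full-trimmed-Sylvester-rank. -/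

import Mathlib

open scoped Polynomial

noncomputable section

namespace PolyMat

/-- The linear space of `m × N` polynomial matrices whose `i`-th row has degree at most `d i`. -/
def rowBounded (F : Type*) [Field F] {m : ℕ} (N : ℕ) (d : Fin m → ℕ) :
    Submodule F (Matrix (Fin m) (Fin N) F[X]) where
  carrier := {M | ∀ i j, (M i j).natDegree ≤ d i}
  zero_mem' := by intro i j; simp
  add_mem' := by
    intro A B hA hB i j
    exact Polynomial.natDegree_add_le_of_degree_le (hA i j) (hB i j)
  smul_mem' := by
    intro c A hA i j
    exact (Polynomial.natDegree_smul_le c (A i j)).trans (hA i j)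

variable {F : Type*} [Field F] {m N : ℕ}

/-- The `k`-th Sylvester matrix of a polynomial matrix `M = M_0 + M_1 λ + ⋯ + M_D λ^D`, of degree at
most `D`: it has `k + D` block rows and `k` block columns, and its block in position `(r, c)`
is `M_{r - c}` if `c ≤ r`, and `0` otherwise. -/
def sylvester (D k : ℕ) (M : Matrix (Fin m) (Fin N) F[X]) :
    Matrix (Fin (k + D) × Fin m) (Fin k × Fin N) F :=
  Matrix.of fun p q =>
    if (q.1 : ℕ) ≤ (p.1 : ℕ) then (M p.2 q.2).coeff ((p.1 : ℕ) - (q.1 : ℕ)) else 0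

/-- The indices of the rows of the `k`-th Sylvester matrix (with `D = max d_i`) that are kept in
the `k`-th trimmed Sylvester matrix: for each `i`, among the `k + D` rows coming from the `i`-th row
of `M`, the `D - d i` last ones are removed. -/
abbrev TrimmedRow (d : Fin m → ℕ) (k : ℕ) : Type :=
  {p : Fin (k + Finset.univ.sup d) × Fin m // (p.1 : ℕ) < k + d p.2}

/-- The `k`-th trimmed Sylvester matrix of a polynomial matrix with row degrees at most `d i`. -/
def trimmedSylvester (d : Fin m → ℕ) (k : ℕ) (M : Matrix (Fin m) (Fin N) F[X]) :
    Matrix (TrimmedRow d k) (Fin k × Fin N) F :=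
  (sylvester (Finset.univ.sup d) k M).submatrix Subtype.val id

/-- The trimmed Sylvester matrix has `k m + ∑ d_i` rows. -/
theorem card_trimmedRow (d : Fin m → ℕ) (k : ℕ) :
    Fintype.card (TrimmedRow d k) = k * m + ∑ i, d i := by
  have e : TrimmedRow d k ≃ (Σ i : Fin m, Fin (k + d i)) :=
    { toFun := fun p => ⟨p.1.2, ⟨p.1.1, p.2⟩⟩
      invFun := fun q => ⟨(⟨q.2, q.2.isLt.trans_le
        (Nat.add_le_add_left (Finset.le_sup (f := d) (Finset.mem_univ q.1)) k)⟩, q.1), q.2.isLt⟩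
      left_inv := fun _ => rfl
      right_inv := fun _ => rfl }
  rw [Fintype.card_congr e, Fintype.card_sigma]
  simp [Finset.sum_add_distrib, mul_comm]

/-- All the trimmed Sylvester matrices `T_1, T_2, …` have full rank. -/
def FullTrimmedSylvesterRank (d : Fin m → ℕ) (M : Matrix (Fin m) (Fin N) F[X]) : Prop :=
  ∀ k : ℕ, 1 ≤ k → (trimmedSylvester d k M).rank = min (k * m + ∑ i, d i) (k * N)

/-- The set of full-trimmed-Sylvester-rank matrices inside `rowBounded F N d`. -/
def TSyl (F : Type*) [Field F] {m : ℕ} (N : ℕ) (d : Fin m → ℕ) :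
    Set (Matrix (Fin m) (Fin N) F[X]) :=
  {M | M ∈ rowBounded F N d ∧ FullTrimmedSylvesterRank d M}

/-- The leading row-wise coefficient matrix: its `i`-th row is the vector coefficient of `λ^{d i}`
in the `i`-th row of `M`. -/
def leadingRowwise (d : Fin m → ℕ) (M : Matrix (Fin m) (Fin N) F[X]) :
    Matrix (Fin m) (Fin N) F :=
  Matrix.of fun i j => (M i j).coeff (d i)

/-- The distance `ρ`: the Euclidean distance between the lists of row coefficients. -/
def rho {𝕜 : Type*} [RCLike 𝕜] (d : Fin m → ℕ) (M M' : Matrix (Fin m) (Fin N) 𝕜[X]) : ℝ :=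
  Real.sqrt (∑ i, ∑ j ∈ Finset.range (d i + 1),
    ‖WithLp.toLp 2 (fun l => (M i l).coeff j - (M' i l).coeff j)‖ ^ 2)

/-- The degree of a polynomial vector: the highest degree of its entries. -/
def vecDegree (v : Fin N → F[X]) : ℕ := Finset.univ.sup fun j => (v j).natDegree

/-- A polynomial vector, seen as a rational vector. -/
def toRat (v : Fin N → F[X]) : Fin N → RatFunc F := fun j => algebraMap F[X] (RatFunc F) (v j)

/-- `v` is a basis, consisting of polynomial vectors, of the rational subspace `V`. -/
structure IsPolyBasis (V : Submodule (RatFunc F) (Fin N → RatFunc F)) {r : ℕ}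
    (v : Fin r → Fin N → F[X]) : Prop where
  linearIndependent : LinearIndependent (RatFunc F) fun i => toRat (v i)
  span_eq : Submodule.span (RatFunc F) (Set.range fun i => toRat (v i)) = V

/-- `v` is a minimal basis of the rational subspace `V`: a polynomial basis whose sum of degrees
is minimal among all polynomial bases of `V`. -/
structure IsMinimalBasisOf (V : Submodule (RatFunc F) (Fin N → RatFunc F)) {r : ℕ}
    (v : Fin r → Fin N → F[X]) : Prop where
  isPolyBasis : IsPolyBasis V v
  sum_le : ∀ w : Fin r → Fin N → F[X], IsPolyBasis V w →
    ∑ i, vecDegree (v i) ≤ ∑ i, vecDegree (w i)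

/-- A polynomial matrix (with fewer rows than columns) is a minimal basis if its rows form a minimal
basis of the rational subspace that they span. -/
def IsMinimalBasis (M : Matrix (Fin m) (Fin N) F[X]) : Prop :=
  IsMinimalBasisOf (Submodule.span (RatFunc F) (Set.range fun i => toRat (M i))) fun i => M i

/-- The multiset `s` is the multiset of minimal indices of `V`: minimal bases of `V` exist, and the
degrees of the vectors of each of them, counted with multiplicity, are given by `s`. -/
def HasMinimalIndices (V : Submodule (RatFunc F) (Fin N → RatFunc F)) (s : Multiset ℕ) : Prop :=
  (∃ (r : ℕ) (v : Fin r → Fin N → F[X]), IsMinimalBasisOf V v) ∧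
    ∀ (r : ℕ) (v : Fin r → Fin N → F[X]), IsMinimalBasisOf V v →
      (Finset.univ : Finset (Fin r)).val.map (fun i => vecDegree (v i)) = s

/-- The rational right null space of a polynomial matrix. -/
def rightNullSpace (M : Matrix (Fin m) (Fin N) F[X]) :
    Submodule (RatFunc F) (Fin N → RatFunc F) :=
  LinearMap.ker (M.map (algebraMap F[X] (RatFunc F))).mulVecLin

/-- `s` is the multiset of right minimal indices of `M`. -/
def HasRightMinimalIndices (M : Matrix (Fin m) (Fin N) F[X]) (s : Multiset ℕ) : Prop :=
  HasMinimalIndices (rightNullSpace M) s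

end PolyMat

end

/-! Multiplication by $T_k(M)$ is the map $x\mapsto Mx$ from polynomial vectors of degree $<k$ to
vectors whose $i$th entry has degree $<k+d_i$. Surjectivity of this map passes to larger $k$,
injectivity to smaller $k$. Since $n(k'-1)\le\sum d_i\le nk'$, full-trimmed-Sylvester-rank amounts
to two conditions: $T_{k'}$ is surjective and $T_{k'-1}$ is injective
(`fullTrimmedSylvesterRank_iff`).

Both conditions are open, which gives (b). On a line of matrices each fails at finitely many
parameters as soon as it holds at one, so density needs only one witness for each. Both come from
$[\mathrm{diag}(p_i)\mid \lambda^{jk}\bmod p_i]$ with coprime monic $p_i$ of degree $d_i$, where the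
Chinese remainder theorem and expansion in base $\lambda^k$ decide solvability
(`diagResidues_surjective`, `diagResidues_injective`).

For (a1), surjectivity of $T_{k'}$ yields a leading matrix of full row rank and a polynomial right
inverse. The predictable degree property then bounds every competing basis from below.

For (a2), let $K_k$ be the space of kernel vectors of degree $<k$. Rank-nullity gives dimensions
$0$, $t$, $n+t$ for $K_{k'-1}$, $K_{k'}$, $K_{k'+1}$. So no basis vector has degree below $k'-1$ and
at most $t$ have degree $k'-1$; a basis attaining this bound is built by extending leading
coefficient vectors (`exists_leading_independent_family`). -/

namespace PolyMat

open Polynomial Matrix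

/-! ### Trimmed Sylvester matrices as multiplication maps on polynomial vectors. -/

section Coefficients

variable {F : Type*} [Field F] {m N : ℕ}

/-- The polynomial vector of degree less than `k` with prescribed coefficients. -/
noncomputable def ofCoeffs (F : Type*) [Field F] (N k : ℕ) :
    (Fin k × Fin N → F) →ₗ[F] (Fin N → F[X]) where
  toFun x j := ∑ a : Fin k, monomial (a : ℕ) (x (a, j))
  map_add' x y := by ext1 j; simp [Finset.sum_add_distrib]
  map_smul' c x := by ext1 j; simp [Finset.smul_sum, smul_monomial]

theorem ofCoeffs_apply (k : ℕ) (x : Fin k × Fin N → F) (j : Fin N) :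
    ofCoeffs F N k x j = ∑ a : Fin k, monomial (a : ℕ) (x (a, j)) := rfl

theorem coeff_ofCoeffs (k : ℕ) (x : Fin k × Fin N → F) (j : Fin N) (a : Fin k) :
    (ofCoeffs F N k x j).coeff a = x (a, j) := by
  simp [ofCoeffs_apply, finsetSum_coeff, coeff_monomial, Fin.val_inj]

theorem ofCoeffs_injective (k : ℕ) : Function.Injective (ofCoeffs F N k) := by
  intro x y h
  ext ⟨a, j⟩
  rw [← coeff_ofCoeffs k x, h, coeff_ofCoeffs]

theorem ofCoeffs_mem_degreeLT (k : ℕ) (x : Fin k × Fin N → F) (j : Fin N) :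
    ofCoeffs F N k x j ∈ degreeLT F k := by
  rw [ofCoeffs_apply]
  exact Submodule.sum_mem _ fun a _ => mem_degreeLT.2
    ((degree_monomial_le _ _).trans_lt (by exact_mod_cast a.isLt))

theorem exists_ofCoeffs_eq (k : ℕ) (x : Fin N → F[X]) (hx : ∀ j, x j ∈ degreeLT F k) :
    ∃ c, ofCoeffs F N k c = x := by
  refine ⟨fun p => (x p.2).coeff p.1, ?_⟩
  ext j b
  by_cases hb : b < k
  · exact coeff_ofCoeffs k _ j ⟨b, hb⟩
  · have h1 := mem_degreeLT.1 (ofCoeffs_mem_degreeLT k (fun p => (x p.2).coeff p.1) j)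
    have h2 := mem_degreeLT.1 (hx j)
    have hb' : k ≤ b := not_lt.1 hb
    rw [(degree_lt_iff_coeff_zero _ _).1 h1 b hb', (degree_lt_iff_coeff_zero _ _).1 h2 b hb']

theorem coeff_mul_monomial_eq_ite (p : F[X]) (n b : ℕ) (c : F) :
    (p * monomial n c).coeff b = if n ≤ b then p.coeff (b - n) * c else 0 := by
  rw [← C_mul_X_pow_eq_monomial, ← mul_assoc, coeff_mul_X_pow']
  simp [coeff_mul_C]

theorem trimmedSylvester_mulVec (d : Fin m → ℕ) (k : ℕ) (M : Matrix (Fin m) (Fin N) F[X])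
    (x : Fin k × Fin N → F) (p : TrimmedRow d k) :
    (trimmedSylvester d k M *ᵥ x) p = ((M *ᵥ ofCoeffs F N k x) p.1.2).coeff p.1.1 := by
  simp only [mulVec, dotProduct, trimmedSylvester, sylvester, submatrix_apply, of_apply, id,
    finsetSum_coeff, ofCoeffs_apply, Finset.mul_sum, coeff_mul_monomial_eq_ite,
    Fintype.sum_prod_type]
  rw [Finset.sum_comm]
  simp only [ite_mul, zero_mul]

theorem mul_mem_degreeLT {p q : F[X]} {e k : ℕ} (hp : p.natDegree ≤ e) (hq : q ∈ degreeLT F k) :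
    p * q ∈ degreeLT F (k + e) := by
  by_cases h : q = 0
  · simp [h]
  have hq' := (natDegree_lt_iff_degree_lt h).2 (mem_degreeLT.1 hq)
  refine mem_degreeLT.2 (degree_le_natDegree.trans_lt ?_)
  have := natDegree_mul_le (p := p) (q := q)
  exact_mod_cast (by omega : (p * q).natDegree < k + e)

theorem mulVec_mem_degreeLT {d : Fin m → ℕ} {M : Matrix (Fin m) (Fin N) F[X]}
    (hM : M ∈ rowBounded F N d) {k : ℕ} {x : Fin N → F[X]} (hx : ∀ j, x j ∈ degreeLT F k)
    (i : Fin m) : (M *ᵥ x) i ∈ degreeLT F (k + d i) := by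
  rw [mulVec, dotProduct]
  exact Submodule.sum_mem _ fun j _ => mul_mem_degreeLT (hM i j) (hx j)

/-- The index in the trimmed Sylvester matrix of the coefficient of `λ^b` in row `i`. -/
def trimmedRow (d : Fin m → ℕ) (k : ℕ) (i : Fin m) (b : ℕ) (hb : b < k + d i) :
    TrimmedRow d k :=
  ⟨(⟨b, hb.trans_le (Nat.add_le_add_left (Finset.le_sup (f := d) (Finset.mem_univ i)) k)⟩, i), hb⟩

theorem trimmedSylvester_mulVec_eq_iff {d : Fin m → ℕ} {M : Matrix (Fin m) (Fin N) F[X]}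
    (hM : M ∈ rowBounded F N d) (k : ℕ) (x : Fin k × Fin N → F) {y : Fin m → F[X]}
    (hy : ∀ i, y i ∈ degreeLT F (k + d i)) :
    (trimmedSylvester d k M *ᵥ x = fun p => (y p.1.2).coeff p.1.1) ↔
      M *ᵥ ofCoeffs F N k x = y := by
  constructor
  · intro h
    ext i b
    by_cases hb : b < k + d i
    · have := congrFun h (trimmedRow d k i b hb)
      rwa [trimmedSylvester_mulVec] at this
    · have h1 := mem_degreeLT.1 (mulVec_mem_degreeLT hM (ofCoeffs_mem_degreeLT k x) i)
      have h2 := mem_degreeLT.1 (hy i)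
      rw [(degree_lt_iff_coeff_zero _ _).1 h1 b (not_lt.1 hb),
        (degree_lt_iff_coeff_zero _ _).1 h2 b (not_lt.1 hb)]
  · intro h
    ext p
    rw [trimmedSylvester_mulVec, h]

theorem trimmedSylvester_mulVec_eq_zero_iff {d : Fin m → ℕ} {M : Matrix (Fin m) (Fin N) F[X]}
    (hM : M ∈ rowBounded F N d) (k : ℕ) (x : Fin k × Fin N → F) :
    trimmedSylvester d k M *ᵥ x = 0 ↔ M *ᵥ ofCoeffs F N k x = 0 := by
  rw [← trimmedSylvester_mulVec_eq_iff hM k x (y := 0) (fun i => zero_mem _)]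
  rfl

theorem trimmedSylvester_surjective_iff {d : Fin m → ℕ} {M : Matrix (Fin m) (Fin N) F[X]}
    (hM : M ∈ rowBounded F N d) (k : ℕ) :
    Function.Surjective (trimmedSylvester d k M).mulVec ↔
      ∀ y : Fin m → F[X], (∀ i, y i ∈ degreeLT F (k + d i)) →
        ∃ x : Fin N → F[X], (∀ j, x j ∈ degreeLT F k) ∧ M *ᵥ x = y := by
  constructor
  · intro h y hy
    obtain ⟨c, hc⟩ := h fun p => (y p.1.2).coeff p.1.1
    exact ⟨_, ofCoeffs_mem_degreeLT k c, (trimmedSylvester_mulVec_eq_iff hM k c hy).1 hc⟩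
  · intro h z
    let y : Fin m → F[X] := fun i =>
      ∑ b : Fin (k + d i), monomial (b : ℕ) (z (trimmedRow d k i b b.isLt))
    have hy : ∀ i, y i ∈ degreeLT F (k + d i) := fun i => Submodule.sum_mem _ fun b _ =>
      mem_degreeLT.2 ((degree_monomial_le _ _).trans_lt (by exact_mod_cast b.isLt))
    obtain ⟨x, hx, hxy⟩ := h y hy
    obtain ⟨c, rfl⟩ := exists_ofCoeffs_eq k x hx
    refine ⟨c, ((trimmedSylvester_mulVec_eq_iff hM k c hy).2 hxy).trans ?_⟩
    ext ⟨⟨b, i⟩, hb⟩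
    simp only [y, finsetSum_coeff, coeff_monomial]
    rw [Finset.sum_eq_single (⟨b, hb⟩ : Fin (k + d i))]
    · simp [trimmedRow]
    · intro b' _ hne
      rw [if_neg fun h => hne (Fin.ext h)]
    · simp

theorem trimmedSylvester_injective_iff {d : Fin m → ℕ} {M : Matrix (Fin m) (Fin N) F[X]}
    (hM : M ∈ rowBounded F N d) (k : ℕ) :
    Function.Injective (trimmedSylvester d k M).mulVec ↔
      ∀ x : Fin N → F[X], (∀ j, x j ∈ degreeLT F k) → M *ᵥ x = 0 → x = 0 := by
  have key : Function.Injective (trimmedSylvester d k M).mulVec ↔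
      ∀ c, trimmedSylvester d k M *ᵥ c = 0 → c = 0 :=
    injective_iff_map_eq_zero (trimmedSylvester d k M).mulVecLin
  rw [key]
  constructor
  · intro h x hx hMx
    obtain ⟨c, rfl⟩ := exists_ofCoeffs_eq k x hx
    rw [h c ((trimmedSylvester_mulVec_eq_zero_iff hM k c).2 hMx), map_zero]
  · intro h c hc
    have := h _ (ofCoeffs_mem_degreeLT k c) ((trimmedSylvester_mulVec_eq_zero_iff hM k c).1 hc)
    exact ofCoeffs_injective k (this.trans (map_zero _).symm)

/-- Write $y=y(0)+\lambda y'$ and solve for the two parts separately. The constant part lies in the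
range of degrees handled at level `l` because `l` is at least 1. -/
theorem trimmedSylvester_surjective_mono {d : Fin m → ℕ} {M : Matrix (Fin m) (Fin N) F[X]}
    (hM : M ∈ rowBounded F N d) {k l : ℕ} (hk : 1 ≤ k) (hkl : k ≤ l)
    (h : Function.Surjective (trimmedSylvester d k M).mulVec) :
    Function.Surjective (trimmedSylvester d l M).mulVec := by
  induction l, hkl using Nat.le_induction with
  | base => exact h
  | succ l hl ih =>
    rw [trimmedSylvester_surjective_iff hM] at ih ⊢
    intro y hy
    obtain ⟨x₀, hx₀, h₀⟩ := ih (fun i => C ((y i).coeff 0)) fun i => mem_degreeLT.2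
      (degree_C_le.trans_lt (by exact_mod_cast (by omega : 0 < l + d i)))
    obtain ⟨x₁, hx₁, h₁⟩ := ih (fun i => divX (y i)) fun i => by
      rw [mem_degreeLT, degree_lt_iff_coeff_zero]
      intro b hb
      rw [coeff_divX]
      exact (degree_lt_iff_coeff_zero _ _).1 (mem_degreeLT.1 (hy i)) _ (by omega)
    refine ⟨x₀ + (X : F[X]) • x₁, fun j => Submodule.add_mem _
      (degreeLT_mono (Nat.le_succ l) (hx₀ j)) ?_, ?_⟩
    · have := mul_mem_degreeLT (natDegree_X_le (R := F)) (hx₁ j)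
      exact this
    · rw [mulVec_add, mulVec_smul, h₀, h₁]
      ext1 i
      simp [add_comm, X_mul_divX_add]

theorem trimmedSylvester_injective_anti {d : Fin m → ℕ} {M : Matrix (Fin m) (Fin N) F[X]}
    (hM : M ∈ rowBounded F N d) {k l : ℕ} (hkl : k ≤ l)
    (h : Function.Injective (trimmedSylvester d l M).mulVec) :
    Function.Injective (trimmedSylvester d k M).mulVec := by
  rw [trimmedSylvester_injective_iff hM] at h ⊢
  exact fun x hx => h x fun j => degreeLT_mono hkl (hx j)

end Coefficients

/-! ### Full rank along a line of matrices. -/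

section Rank

variable {F : Type*} [Field F] {p q : Type*} [Fintype q]

theorem rank_eq_card_rows_iff [Fintype p] (A : Matrix p q F) :
    A.rank = Fintype.card p ↔ Function.Surjective A.mulVec := by
  rw [← coe_mulVecLin, ← LinearMap.range_eq_top, Matrix.rank]
  constructor
  · intro h
    exact Submodule.eq_top_of_finrank_eq (by rw [h, Module.finrank_fintype_fun_eq_card])
  · intro h
    rw [h, finrank_top, Module.finrank_fintype_fun_eq_card]

theorem rank_add_finrank_ker (A : Matrix p q F) :
    A.rank + Module.finrank F (LinearMap.ker A.mulVecLin) = Fintype.card q := by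
  rw [Matrix.rank, LinearMap.finrank_range_add_finrank_ker, Module.finrank_fintype_fun_eq_card]

theorem rank_eq_card_cols_iff (A : Matrix p q F) :
    A.rank = Fintype.card q ↔ Function.Injective A.mulVec := by
  rw [← coe_mulVecLin, ← LinearMap.ker_eq_bot, ← Submodule.finrank_eq_zero,
    ← rank_add_finrank_ker A]
  omega

variable [Fintype p]

theorem mulVec_injective_iff_exists_left_inverse [DecidableEq q] {A : Matrix p q F} :
    Function.Injective A.mulVec ↔ ∃ B : Matrix q p F, B * A = 1 := by
  constructor
  · intro h
    have h' : Function.Surjective Aᵀ.mulVec := by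
      rw [← rank_eq_card_rows_iff, rank_transpose, rank_eq_card_cols_iff]
      exact h
    obtain ⟨B, hB⟩ := mulVec_surjective_iff_exists_right_inverse.1 h'
    refine ⟨Bᵀ, ?_⟩
    rw [← transpose_transpose A, ← transpose_mul, hB, transpose_one]
  · rintro ⟨B, hB⟩ x y hxy
    rw [← one_mulVec x, ← one_mulVec y, ← hB, ← mulVec_mulVec, ← mulVec_mulVec]
    exact congrArg _ hxy

/-- The determinant is a polynomial in `s`, nonzero because it does not vanish at `s₀`. -/
theorem finite_setOf_det_add_smul_eq_zero [DecidableEq p] (A B : Matrix p p F) (s₀ : F)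
    (h : (A + s₀ • B).det ≠ 0) : {s : F | (A + s • B).det = 0}.Finite := by
  let P : F[X] := (A.map C + (X : F[X]) • B.map C).det
  have hP : ∀ s, P.eval s = (A + s • B).det := by
    intro s
    rw [← coe_evalRingHom, RingHom.map_det]
    congr 1
    ext i j
    simp only [coe_evalRingHom, RingHom.mapMatrix_apply, map_apply, Matrix.add_apply, Matrix.smul_apply,
      smul_eq_mul, eval_add, eval_mul, eval_X, eval_C]
  have hP0 : P ≠ 0 := by
    intro h0
    apply h
    rw [← hP, h0, eval_zero]
  refine (P.finite_setOfPred_isRoot hP0).subset fun s hs => ?_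
  simpa [IsRoot, hP] using hs

/-- A right inverse `G` at `s₀`, kept fixed, makes $(A+sB)G$ square with determinant $1$ at `s₀`.
Wherever this determinant is nonzero, surjectivity holds. -/
theorem finite_setOf_not_surjective_add_smul (A B : Matrix p q F) (s₀ : F)
    (h : Function.Surjective (A + s₀ • B).mulVec) :
    {s : F | ¬ Function.Surjective (A + s • B).mulVec}.Finite := by
  classical
  obtain ⟨G, hG⟩ := mulVec_surjective_iff_exists_right_inverse.1 h
  refine (finite_setOf_det_add_smul_eq_zero (A * G) (B * G) s₀ ?_).subset fun s hs => ?_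
  · rw [← smul_mul, ← Matrix.add_mul, hG, det_one]
    exact one_ne_zero
  · by_contra hdet
    apply hs
    rw [Set.mem_ofPred_eq, ← smul_mul, ← Matrix.add_mul] at hdet
    refine mulVec_surjective_iff_exists_right_inverse.2
      ⟨G * ((A + s • B) * G)⁻¹, ?_⟩
    rw [← Matrix.mul_assoc, mul_nonsing_inv _ (isUnit_iff_ne_zero.2 hdet)]

theorem finite_setOf_not_injective_add_smul (A B : Matrix p q F) (s₀ : F)
    (h : Function.Injective (A + s₀ • B).mulVec) :
    {s : F | ¬ Function.Injective (A + s • B).mulVec}.Finite := by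
  classical
  obtain ⟨G, hG⟩ := mulVec_injective_iff_exists_left_inverse.1 h
  refine (finite_setOf_det_add_smul_eq_zero (G * A) (G * B) s₀ ?_).subset fun s hs => ?_
  · rw [← Matrix.mul_smul, ← Matrix.mul_add, hG, det_one]
    exact one_ne_zero
  · by_contra hdet
    apply hs
    rw [Set.mem_ofPred_eq, ← Matrix.mul_smul, ← Matrix.mul_add] at hdet
    refine mulVec_injective_iff_exists_left_inverse.2
      ⟨(G * (A + s • B))⁻¹ * G, ?_⟩
    rw [Matrix.mul_assoc, nonsing_inv_mul _ (isUnit_iff_ne_zero.2 hdet)]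

end Rank

/-! ### Openness of the full-rank conditions. -/

section RankOpen

variable {𝕜 : Type*} [RCLike 𝕜] {p q : Type*} [Fintype p] [Fintype q]

theorem isOpen_setOf_mulVec_surjective :
    IsOpen {A : Matrix p q 𝕜 | Function.Surjective A.mulVec} := by
  classical
  rw [isOpen_iff_mem_nhds]
  intro A hA
  obtain ⟨G, hG⟩ := mulVec_surjective_iff_exists_right_inverse.1 hA
  have hc : Continuous fun A' : Matrix p q 𝕜 => (A' * G).det := by fun_prop
  have h1 : (A * G).det ≠ 0 := by simp [hG]
  filter_upwards [hc.continuousAt.eventually_ne h1] with A' hA'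
  refine mulVec_surjective_iff_exists_right_inverse.2 ⟨G * (A' * G)⁻¹, ?_⟩
  rw [← Matrix.mul_assoc, mul_nonsing_inv _ (isUnit_iff_ne_zero.2 hA')]

theorem isOpen_setOf_mulVec_injective :
    IsOpen {A : Matrix p q 𝕜 | Function.Injective A.mulVec} := by
  classical
  rw [isOpen_iff_mem_nhds]
  intro A hA
  obtain ⟨G, hG⟩ := mulVec_injective_iff_exists_left_inverse.1 hA
  have hc : Continuous fun A' : Matrix p q 𝕜 => (G * A').det := by fun_prop
  have h1 : (G * A).det ≠ 0 := by simp [hG]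
  filter_upwards [hc.continuousAt.eventually_ne h1] with A' hA'
  refine mulVec_injective_iff_exists_left_inverse.2 ⟨(G * A')⁻¹ * G, ?_⟩
  rw [Matrix.mul_assoc, nonsing_inv_mul _ (isUnit_iff_ne_zero.2 hA')]

end RankOpen

/-! ### Reduction of full-trimmed-Sylvester-rank to two sizes. -/

section FullRank

variable {F : Type*} [Field F] {m n : ℕ}

/-- The difference between the numbers of columns and rows of $T_l$ is $nl-\sum d_i$, so full rank
means surjective for $l\ge k$ and injective for $l\le k-1$. Monotonicity leaves only the two extreme
cases. -/
theorem fullTrimmedSylvesterRank_iff {d : Fin m → ℕ} {M : Matrix (Fin m) (Fin (m + n)) F[X]}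
    (hM : M ∈ rowBounded F (m + n) d) {k : ℕ} (hk : 1 ≤ k) (hlo : n * (k - 1) ≤ ∑ i, d i)
    (hhi : ∑ i, d i ≤ n * k) :
    FullTrimmedSylvesterRank d M ↔ Function.Surjective (trimmedSylvester d k M).mulVec ∧
      Function.Injective (trimmedSylvester d (k - 1) M).mulVec := by
  have hrows (l : ℕ) (hl : k ≤ l) : min (l * m + ∑ i, d i) (l * (m + n)) =
      Fintype.card (TrimmedRow d l) := by
    rw [card_trimmedRow]
    have := Nat.mul_le_mul_left n hl
    exact min_eq_left (by linarith [mul_add l m n, mul_comm l n])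
  have hcols (l : ℕ) (hl : l ≤ k - 1) : min (l * m + ∑ i, d i) (l * (m + n)) =
      Fintype.card (Fin l × Fin (m + n)) := by
    have := Nat.mul_le_mul_left n hl
    simpa using (by linarith [mul_add l m n, mul_comm l n] : l * (m + n) ≤ l * m + ∑ i, d i)
  constructor
  · intro h
    refine ⟨(rank_eq_card_rows_iff _).1 ((h k hk).trans (hrows k le_rfl)), ?_⟩
    -- The rank hypothesis says nothing about size $0$, but $T_0$ has no columns.
    rcases Nat.eq_zero_or_pos (k - 1) with h0 | h0
    · rw [h0]
      exact Function.injective_of_subsingleton _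
    · exact (rank_eq_card_cols_iff _).1 ((h _ h0).trans (hcols _ le_rfl))
  · rintro ⟨hs, hi⟩ l hl
    rcases le_or_gt k l with hkl | hkl
    · rw [hrows l hkl, rank_eq_card_rows_iff]
      exact trimmedSylvester_surjective_mono hM hk hkl hs
    · rw [hcols l (by omega), rank_eq_card_cols_iff]
      exact trimmedSylvester_injective_anti hM (by omega) hi

theorem trimmedSylvester_add_smul {N : ℕ} (d : Fin m → ℕ) (k : ℕ)
    (A B : Matrix (Fin m) (Fin N) F[X]) (s : F) :
    trimmedSylvester d k (A + s • B) = trimmedSylvester d k A + s • trimmedSylvester d k B := by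
  ext p q
  simp only [trimmedSylvester, sylvester, submatrix_apply, of_apply, Matrix.add_apply,
    Matrix.smul_apply, id, coeff_add, coeff_smul]
  split_ifs <;> simp

end FullRank

/-! ### Expansion of polynomials in base $\lambda^k$. -/

section Blocks

variable {F : Type*} [Field F]

theorem exists_sum_X_pow_mul (k n : ℕ) (g : F[X]) (hg : g ∈ degreeLT F (n * k)) :
    ∃ h : Fin n → F[X], (∀ j, h j ∈ degreeLT F k) ∧ ∑ j : Fin n, X ^ ((j : ℕ) * k) * h j = g := by
  induction n generalizing g with
  | zero =>
    refine ⟨fun _ => 0, fun j => zero_mem _, ?_⟩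
    rw [Nat.zero_mul, mem_degreeLT] at hg
    rw [Fin.sum_univ_zero, eq_comm]
    by_contra h0
    exact absurd (by simpa using hg) (not_lt.2 (zero_le_degree_iff.2 h0))
  | succ n ih =>
    obtain ⟨h, hh, hsum⟩ := ih (g /ₘ X ^ k) (by
      by_cases h0 : g /ₘ X ^ k = 0
      · rw [h0]; exact zero_mem _
      by_cases hg0 : g = 0
      · simp [hg0] at h0
      have h1 := natDegree_divByMonic g (monic_X_pow (R := F) k)
      have h2 := (natDegree_lt_iff_degree_lt hg0).2 (mem_degreeLT.1 hg)
      rw [mem_degreeLT, ← natDegree_lt_iff_degree_lt h0, h1, natDegree_X_pow]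
      rw [Nat.succ_mul] at h2
      -- The bound on the degree of the quotient can fail only through truncated subtraction, that
      -- is when $\deg g<k$; the quotient is then zero.
      by_contra hcon
      have h4 : n * k = 0 := by omega
      have h5 : g.natDegree < k := by omega
      exact h0 ((divByMonic_eq_zero_iff (monic_X_pow k)).2
        (by rw [degree_X_pow]; exact (natDegree_lt_iff_degree_lt hg0).1 h5)))
    refine ⟨Fin.cons (g %ₘ X ^ k) h, fun j => ?_, ?_⟩
    · refine Fin.cases ?_ (fun j => ?_) j
      · simpa [mem_degreeLT] using degree_modByMonic_lt g (monic_X_pow (R := F) k)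
      · simpa using hh j
    · rw [Fin.sum_univ_succ]
      simp only [Fin.val_zero, zero_mul, pow_zero, one_mul, Fin.cons_zero, Fin.val_succ,
        Fin.cons_succ, Nat.succ_mul, pow_add]
      refine Eq.trans ?_ (modByMonic_add_div g (X ^ k))
      rw [← hsum, Finset.mul_sum]
      exact congrArg _ (Finset.sum_congr rfl fun j _ => by ring)

theorem eq_zero_of_sum_X_pow_mul_eq_zero (k n : ℕ) (h : Fin n → F[X])
    (hh : ∀ j, h j ∈ degreeLT F k) (hsum : ∑ j : Fin n, X ^ ((j : ℕ) * k) * h j = 0) : h = 0 := by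
  induction n with
  | zero => exact Subsingleton.elim _ _
  | succ n ih =>
    have key : h 0 + X ^ k * ∑ j : Fin n, X ^ ((j : ℕ) * k) * h j.succ = 0 := by
      rw [← hsum, Fin.sum_univ_succ, Finset.mul_sum]
      congr 1
      · simp
      · refine Finset.sum_congr rfl fun j _ => ?_
        rw [Fin.val_succ, Nat.succ_mul, pow_add]
        ring
    have h0 : h 0 = 0 := by
      refine eq_zero_of_dvd_of_degree_lt (p := X ^ k) ?_ ?_
      · rw [eq_neg_of_add_eq_zero_left key]
        exact (dvd_mul_right _ _).neg_right
      · rw [degree_X_pow]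
        exact mem_degreeLT.1 (hh 0)
    rw [h0, zero_add] at key
    have := ih (fun j => h j.succ) (fun j => hh _)
      ((mul_eq_zero.1 key).resolve_left (pow_ne_zero _ X_ne_zero))
    ext1 j
    refine Fin.cases h0 (fun j => congrFun this j) j

theorem sum_X_pow_mul_mem_degreeLT {k n : ℕ} {h : Fin n → F[X]}
    (hh : ∀ j, h j ∈ degreeLT F k) : ∑ j : Fin n, X ^ ((j : ℕ) * k) * h j ∈ degreeLT F (n * k) := by
  refine Submodule.sum_mem _ fun j _ => degreeLT_mono ?_
    (mul_mem_degreeLT (natDegree_X_pow_le (R := F) _) (hh j))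
  have := Nat.mul_le_mul_right k j.isLt
  rw [Nat.succ_mul] at this
  omega

theorem mem_degreeLT_of_monic_mul {p z : F[X]} (hp : p.Monic) {k : ℕ}
    (h : p * z ∈ degreeLT F (k + p.natDegree)) : z ∈ degreeLT F k := by
  by_cases hz : z = 0
  · simp [hz]
  rw [mem_degreeLT, ← natDegree_lt_iff_degree_lt (mul_ne_zero hp.ne_zero hz),
    hp.natDegree_mul' hz] at h
  rw [mem_degreeLT, ← natDegree_lt_iff_degree_lt hz]
  omega

end Blocks

/-! ### Witnesses from the Chinese remainder theorem. -/

section Witness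

variable {F : Type*} [Field F] {m : ℕ}

/-- The polynomial matrix `[diag(p_i) | λ^{jk} mod p_i]`. -/
noncomputable def diagResidues (n k : ℕ) (p : Fin m → F[X]) :
    Matrix (Fin m) (Fin (m + n)) F[X] :=
  fun i => Fin.addCases (fun l => Pi.single (M := fun _ => F[X]) i (p i) l)
    (fun j => X ^ ((j : ℕ) * k) %ₘ p i)

theorem diagResidues_mulVec (n k : ℕ) (p : Fin m → F[X]) (x : Fin (m + n) → F[X]) (i : Fin m) :
    (diagResidues n k p *ᵥ x) i = p i * x (Fin.castAdd n i) +
      ∑ j : Fin n, (X ^ ((j : ℕ) * k) %ₘ p i) * x (Fin.natAdd m j) := by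
  simp [mulVec, dotProduct, Fin.sum_univ_add, diagResidues, Pi.single_apply]

theorem diagResidues_mem_rowBounded (n k : ℕ) {p : Fin m → F[X]} (hp : ∀ i, (p i).Monic) :
    diagResidues n k p ∈ rowBounded F (m + n) fun i => (p i).natDegree := by
  intro i j
  refine Fin.addCases (fun l => ?_) (fun j => ?_) j
  · simp only [diagResidues, Fin.addCases_left, Pi.single_apply]
    split_ifs <;> simp
  · simp only [diagResidues, Fin.addCases_right]
    exact natDegree_modByMonic_le _ (hp i)

theorem dvd_sum_X_pow_mul_sub (n k : ℕ) (p : F[X]) (h : Fin n → F[X]) :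
    p ∣ ∑ j : Fin n, X ^ ((j : ℕ) * k) * h j - ∑ j : Fin n, (X ^ ((j : ℕ) * k) %ₘ p) * h j := by
  rw [← Finset.sum_sub_distrib]
  refine Finset.dvd_sum fun j _ => ?_
  rw [← sub_mul]
  refine Dvd.dvd.mul_right ⟨X ^ ((j : ℕ) * k) /ₘ p, ?_⟩ _
  rw [sub_eq_iff_eq_add', modByMonic_add_div]

/-- Choose $g\equiv y_i$ modulo every $p_i$, reduced modulo $\prod p_i$ to degree $<\sum d_i\le nk$.
Its $n$ digits in base $\lambda^k$ are the last $n$ unknowns; the remaining ones are quotients by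
the $p_i$. -/
theorem diagResidues_surjective {n k : ℕ} {p : Fin m → F[X]} (hp : ∀ i, (p i).Monic)
    (hcop : Pairwise (Function.onFun IsCoprime p)) (hk : ∑ i, (p i).natDegree ≤ n * k) :
    Function.Surjective
      (trimmedSylvester (fun i => (p i).natDegree) k (diagResidues n k p)).mulVec := by
  rw [trimmedSylvester_surjective_iff (diagResidues_mem_rowBounded n k hp)]
  intro y hy
  obtain ⟨g, hg⟩ := Ideal.exists_forall_sub_mem_ideal (I := fun i => Ideal.span {p i})
    (fun i j hij => (Ideal.isCoprime_span_singleton_iff _ _).2 (hcop hij)) y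
  have hprod : (∏ i, p i).Monic := monic_prod_of_monic _ _ fun i _ => hp i
  obtain ⟨h, hh, hsum⟩ := exists_sum_X_pow_mul k n (g %ₘ ∏ i, p i) (by
    refine degreeLT_mono hk (mem_degreeLT.2 ?_)
    have := degree_modByMonic_lt g hprod
    rwa [degree_eq_natDegree hprod.ne_zero, natDegree_prod_of_monic _ _ fun i _ => hp i] at this)
  have hdvd : ∀ i, p i ∣ y i - ∑ j : Fin n, (X ^ ((j : ℕ) * k) %ₘ p i) * h j := by
    intro i
    have h1 : p i ∣ g - y i := Ideal.mem_span_singleton.1 (hg i)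
    have h2 : p i ∣ g - g %ₘ ∏ i, p i := (Finset.dvd_prod_of_mem p (Finset.mem_univ i)).trans
      ⟨g /ₘ ∏ i, p i, by rw [sub_eq_iff_eq_add', modByMonic_add_div]⟩
    have h3 := dvd_sum_X_pow_mul_sub n k (p i) h
    rw [hsum] at h3
    convert (dvd_sub h2 h1).add h3 using 1
    ring
  choose z hz using hdvd
  refine ⟨Fin.addCases z h, fun j => ?_, ?_⟩
  · refine Fin.addCases (fun i => ?_) (fun j => ?_) j
    · simp only [Fin.addCases_left]
      refine mem_degreeLT_of_monic_mul (hp i) ?_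
      rw [← hz]
      exact Submodule.sub_mem _ (hy i) (Submodule.sum_mem _ fun j _ =>
        mul_mem_degreeLT (natDegree_modByMonic_le _ (hp i)) (hh j))
    · simp only [Fin.addCases_right]
      exact hh j
  · ext1 i
    simp only [diagResidues_mulVec, Fin.addCases_left, Fin.addCases_right, ← hz]
    ring

/-- For a kernel vector, the polynomial whose base-$\lambda^k$ digits are the last $n$ entries is
divisible by $\prod p_i$ but has degree $<nk\le\sum d_i$. It vanishes, so its digits do, and then
the first $m$ entries. -/
theorem diagResidues_injective {n k : ℕ} {p : Fin m → F[X]} (hp : ∀ i, (p i).Monic)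
    (hcop : Pairwise (Function.onFun IsCoprime p)) (hk : n * k ≤ ∑ i, (p i).natDegree) :
    Function.Injective
      (trimmedSylvester (fun i => (p i).natDegree) k (diagResidues n k p)).mulVec := by
  rw [trimmedSylvester_injective_iff (diagResidues_mem_rowBounded n k hp)]
  intro x hx h0
  have hprod : (∏ i, p i).Monic := monic_prod_of_monic _ _ fun i _ => hp i
  have hrow (i : Fin m) := (diagResidues_mulVec n k p x i).symm.trans (congrFun h0 i)
  have hdvd : ∏ i, p i ∣ ∑ j : Fin n, X ^ ((j : ℕ) * k) * x (Fin.natAdd m j) := by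
    refine Finset.prod_dvd_of_coprime (fun i _ j _ hij => hcop hij) fun i _ => ?_
    have h1 := dvd_sum_X_pow_mul_sub n k (p i) fun j => x (Fin.natAdd m j)
    have h2 : p i ∣ ∑ j : Fin n, (X ^ ((j : ℕ) * k) %ₘ p i) * x (Fin.natAdd m j) := by
      rw [eq_neg_of_add_eq_zero_right (hrow i)]
      exact (dvd_mul_right _ _).neg_right
    exact (dvd_sub_left h2).1 h1
  have hz : (fun j => x (Fin.natAdd m j)) = 0 := by
    refine eq_zero_of_sum_X_pow_mul_eq_zero k n _ (fun j => hx _)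
      (eq_zero_of_dvd_of_degree_lt hdvd ?_)
    have h1 := mem_degreeLT.1 (sum_X_pow_mul_mem_degreeLT fun j : Fin n => hx (Fin.natAdd m j))
    rw [degree_eq_natDegree hprod.ne_zero, natDegree_prod_of_monic _ _ fun i _ => hp i]
    exact h1.trans_le (by exact_mod_cast hk)
  ext1 j
  refine Fin.addCases (fun i => ?_) (fun j => congrFun hz j) j
  have h1 := hrow i
  simp only [fun j => congrFun hz j, Pi.zero_apply, mul_zero, Finset.sum_const_zero,
    add_zero] at h1
  exact (mul_eq_zero.1 h1).resolve_left (hp i).ne_zero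

theorem exists_monic_pairwise_isCoprime [CharZero F] (d : Fin m → ℕ) :
    ∃ p : Fin m → F[X], (∀ i, (p i).Monic) ∧ Pairwise (Function.onFun IsCoprime p) ∧
      (fun i => (p i).natDegree) = d := by
  refine ⟨fun i => (X - C ((i : ℕ) : F)) ^ d i, fun i => (monic_X_sub_C _).pow _,
    fun i j hij => ?_, ?_⟩
  · exact (pairwise_coprime_X_sub_C (s := fun i : Fin m => ((i : ℕ) : F))
      (fun a b h => Fin.ext (Nat.cast_injective h)) hij).pow
  · ext1 i
    rw [natDegree_pow, natDegree_X_sub_C, mul_one]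

theorem exists_trimmedSylvester_surjective [CharZero F] (d : Fin m → ℕ) {n k : ℕ}
    (hk : ∑ i, d i ≤ n * k) : ∃ M ∈ rowBounded F (m + n) d,
      Function.Surjective (trimmedSylvester d k M).mulVec := by
  obtain ⟨p, hp, hcop, rfl⟩ := exists_monic_pairwise_isCoprime (F := F) d
  exact ⟨_, diagResidues_mem_rowBounded n k hp, diagResidues_surjective hp hcop hk⟩

theorem exists_trimmedSylvester_injective [CharZero F] (d : Fin m → ℕ) {n k : ℕ}
    (hk : n * k ≤ ∑ i, d i) : ∃ M ∈ rowBounded F (m + n) d,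
      Function.Injective (trimmedSylvester d k M).mulVec := by
  obtain ⟨p, hp, hcop, rfl⟩ := exists_monic_pairwise_isCoprime (F := F) d
  exact ⟨_, diagResidues_mem_rowBounded n k hp, diagResidues_injective hp hcop hk⟩

theorem finite_setOf_add_smul_sub_not {N : ℕ} (d : Fin m → ℕ) (k l : ℕ)
    (A B : Matrix (Fin m) (Fin N) F[X]) (s₀ s₁ : F)
    (h₀ : Function.Surjective (trimmedSylvester d k (A + s₀ • B)).mulVec)
    (h₁ : Function.Injective (trimmedSylvester d l (A + s₁ • B)).mulVec) :
    {s : F | ¬ (Function.Surjective (trimmedSylvester d k (A + s • B)).mulVec ∧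
      Function.Injective (trimmedSylvester d l (A + s • B)).mulVec)}.Finite := by
  simp only [trimmedSylvester_add_smul] at h₀ h₁ ⊢
  refine ((finite_setOf_not_surjective_add_smul _ _ s₀ h₀).union
    (finite_setOf_not_injective_add_smul _ _ s₁ h₁)).subset fun s hs => ?_
  exact not_and_or.1 hs

/-- The two witnesses are built with different exponents `k` and `l`. On the line joining them each
property fails only finitely often, and the field is infinite. -/
theorem exists_surjective_and_injective [CharZero F] (d : Fin m → ℕ) {n k l : ℕ}
    (hk : ∑ i, d i ≤ n * k) (hl : n * l ≤ ∑ i, d i) : ∃ M ∈ rowBounded F (m + n) d,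
      Function.Surjective (trimmedSylvester d k M).mulVec ∧
      Function.Injective (trimmedSylvester d l M).mulVec := by
  obtain ⟨A, hA, hAs⟩ := exists_trimmedSylvester_surjective (F := F) d hk
  obtain ⟨B, hB, hBi⟩ := exists_trimmedSylvester_injective (F := F) d hl
  have hfin := finite_setOf_add_smul_sub_not d k l A (B - A) 0 1 (by simpa using hAs)
    (by simpa using hBi)
  obtain ⟨s, hs⟩ := hfin.infinite_compl.nonempty
  exact ⟨A + s • (B - A), Submodule.add_mem _ hA (Submodule.smul_mem _ _
    (Submodule.sub_mem _ hB hA)), by simpa using hs⟩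

end Witness

/-! ### The distance `rho`: openness and density. -/

section Distance

open Filter Topology

variable {𝕜 : Type*} [RCLike 𝕜] {m N : ℕ}

theorem norm_coeff_sub_le_rho {d : Fin m → ℕ} (M M' : Matrix (Fin m) (Fin N) 𝕜[X]) (i : Fin m)
    (l : Fin N) {b : ℕ} (hb : b ≤ d i) :
    ‖(M i l).coeff b - (M' i l).coeff b‖ ≤ rho d M M' := by
  refine Real.le_sqrt_of_sq_le ?_
  have h1 : ‖(M i l).coeff b - (M' i l).coeff b‖ ≤
      ‖WithLp.toLp 2 (fun l => (M i l).coeff b - (M' i l).coeff b)‖ :=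
    PiLp.norm_apply_le (WithLp.toLp 2 (fun l => (M i l).coeff b - (M' i l).coeff b)) l
  refine (pow_le_pow_left₀ (norm_nonneg _) h1 2).trans ?_
  refine le_trans ?_ (Finset.single_le_sum (fun i _ => Finset.sum_nonneg fun _ _ => sq_nonneg _)
    (Finset.mem_univ i))
  exact Finset.single_le_sum (f := fun b =>
    ‖WithLp.toLp 2 (fun l => (M i l).coeff b - (M' i l).coeff b)‖ ^ 2)
    (fun _ _ => sq_nonneg _) (Finset.mem_range.2 (Nat.lt_succ_of_le hb))

theorem norm_trimmedSylvester_sub_le_rho {d : Fin m → ℕ} {M M' : Matrix (Fin m) (Fin N) 𝕜[X]}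
    (hM : M ∈ rowBounded 𝕜 N d) (hM' : M' ∈ rowBounded 𝕜 N d) (k : ℕ) (p : TrimmedRow d k)
    (q : Fin k × Fin N) :
    ‖trimmedSylvester d k M p q - trimmedSylvester d k M' p q‖ ≤ rho d M M' := by
  simp only [trimmedSylvester, sylvester, submatrix_apply, of_apply, id]
  split_ifs with h
  -- `rho` sees only the coefficients up to `d i`; the higher ones vanish in both matrices.
  · rcases le_or_gt ((p.1.1 : ℕ) - q.1) (d p.1.2) with hb | hb
    · exact norm_coeff_sub_le_rho M M' _ _ hb
    · rw [coeff_eq_zero_of_natDegree_lt ((hM _ _).trans_lt hb),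
        coeff_eq_zero_of_natDegree_lt ((hM' _ _).trans_lt hb), sub_zero, norm_zero]
      exact Real.sqrt_nonneg _
  · rw [sub_zero, norm_zero]
    exact Real.sqrt_nonneg _

theorem exists_forall_rho_lt_mem {d : Fin m → ℕ} {M' : Matrix (Fin m) (Fin N) 𝕜[X]}
    (hM' : M' ∈ rowBounded 𝕜 N d) (k : ℕ)
    {U : Set (Matrix (TrimmedRow d k) (Fin k × Fin N) 𝕜)} (hU : IsOpen U)
    (h : trimmedSylvester d k M' ∈ U) :
    ∃ ε : ℝ, 0 < ε ∧ ∀ M ∈ rowBounded 𝕜 N d, rho d M M' < ε → trimmedSylvester d k M ∈ U := by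
  have hU' : IsOpen (X := TrimmedRow d k → Fin k × Fin N → 𝕜) U := hU
  obtain ⟨ε, hε, hball⟩ := Metric.isOpen_iff.1 hU' _ h
  refine ⟨ε, hε, fun M hM hρ => hball ?_⟩
  refine (dist_pi_lt_iff (X := fun _ : TrimmedRow d k => Fin k × Fin N → 𝕜) hε).2 fun p =>
    (dist_pi_lt_iff hε).2 fun q => ?_
  rw [dist_eq_norm]
  exact (norm_trimmedSylvester_sub_le_rho hM hM' k p q).trans_lt hρ

theorem tendsto_rho_add_smul (d : Fin m → ℕ) (M D : Matrix (Fin m) (Fin N) 𝕜[X]) :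
    Tendsto (fun s : 𝕜 => rho d M (M + s • D)) (𝓝 0) (𝓝 0) := by
  have hc : Continuous fun s : 𝕜 => rho d M (M + s • D) := by
    simp only [rho, Matrix.add_apply, Matrix.smul_apply, coeff_add, coeff_smul]
    fun_prop
  have h0 : rho d M (M + (0 : 𝕜) • D) = 0 := by
    simp [rho, ← Pi.zero_def]
  exact (hc.tendsto 0).trans_eq (congrArg 𝓝 h0)

theorem exists_rho_lt_surjective_and_injective {n : ℕ} {d : Fin m → ℕ} {k l : ℕ}
    (hk : ∑ i, d i ≤ n * k) (hl : n * l ≤ ∑ i, d i) {M : Matrix (Fin m) (Fin (m + n)) 𝕜[X]}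
    (hM : M ∈ rowBounded 𝕜 (m + n) d) {ε : ℝ} (hε : 0 < ε) :
    ∃ M' ∈ rowBounded 𝕜 (m + n) d, (Function.Surjective (trimmedSylvester d k M').mulVec ∧
      Function.Injective (trimmedSylvester d l M').mulVec) ∧ rho d M M' < ε := by
  obtain ⟨W, hW, hWs, hWi⟩ := exists_surjective_and_injective (F := 𝕜) d hk hl
  have hfin := finite_setOf_add_smul_sub_not d k l M (W - M) 1 1 (by simpa using hWs)
    (by simpa using hWi)
  -- The parameter $0$ itself may be bad, hence the punctured neighbourhood.
  have h1 := (nhdsNE_le_cofinite (0 : 𝕜)) hfin.compl_mem_cofinite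
  have h2 := ((tendsto_rho_add_smul d M (W - M)).eventually_lt_const hε).filter_mono
    (nhdsWithin_le_nhds (s := {0}ᶜ))
  obtain ⟨s, hs, hsε⟩ := (Filter.Eventually.and h1 h2).exists
  exact ⟨M + s • (W - M), Submodule.add_mem _ hM (Submodule.smul_mem _ _
    (Submodule.sub_mem _ hW hM)), by simpa using hs, hsε⟩

end Distance

/-! ### The predictable degree property. -/

section PredictableDegree

variable {F : Type*} [Field F] {N : ℕ} {ι : Type*}

theorem coeff_sum_smul_of_natDegree_add_le [Fintype ι] {v : ι → Fin N → F[X]} {e : ι → ℕ}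
    (hv : ∀ i j, (v i j).natDegree ≤ e i) {a : ι → F[X]} {b : ℕ}
    (hb : ∀ i, a i ≠ 0 → (a i).natDegree + e i ≤ b) (j : Fin N) :
    ((∑ i, a i • v i) j).coeff b =
      ∑ i, (a i).coeff (b - e i) * (v i j).coeff (e i) := by
  rw [Finset.sum_apply, finsetSum_coeff]
  refine Finset.sum_congr rfl fun i _ => ?_
  by_cases ha : a i = 0
  · simp [ha]
  · have h1 := hb i ha
    conv_lhs => rw [show b = b - e i + e i by omega]
    exact coeff_mul_add_eq_of_natDegree_le (by omega) (hv i j)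

/-- At the largest value of $\deg a_i+e_i$ over $a_i\ne0$, the coefficient of the sum is a
nontrivial combination of the independent leading vectors, so nothing cancels. -/
theorem natDegree_add_le_vecDegree_sum_smul [Fintype ι] {v : ι → Fin N → F[X]} {e : ι → ℕ}
    (hv : ∀ i j, (v i j).natDegree ≤ e i)
    (hlead : LinearIndependent F fun i j => (v i j).coeff (e i)) {a : ι → F[X]} {i₀ : ι}
    (ha : a i₀ ≠ 0) :
    (a i₀).natDegree + e i₀ ≤ vecDegree (∑ i, a i • v i) ∧ ∑ i, a i • v i ≠ 0 := by
  classical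
  obtain ⟨i₁, hi₁, hmax⟩ := Finset.exists_max_image (Finset.univ.filter fun i => a i ≠ 0)
    (fun i => (a i).natDegree + e i) ⟨i₀, by simpa using ha⟩
  have hb : ∀ i, a i ≠ 0 → (a i).natDegree + e i ≤ (a i₁).natDegree + e i₁ :=
    fun i hi => hmax i (by simpa using hi)
  have hne : ∃ j, ((∑ i, a i • v i) j).coeff ((a i₁).natDegree + e i₁) ≠ 0 := by
    by_contra! hcon
    have h1 := Fintype.linearIndependent_iff.1 hlead
      (fun i => (a i).coeff ((a i₁).natDegree + e i₁ - e i)) (by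
        ext1 j
        simpa using (coeff_sum_smul_of_natDegree_add_le hv hb j).symm.trans (hcon j)) i₁
    rw [Nat.add_sub_cancel] at h1
    exact (by simpa using hi₁ : a i₁ ≠ 0) (leadingCoeff_eq_zero.1 h1)
  obtain ⟨j, hj⟩ := hne
  refine ⟨(hb i₀ ha).trans ((le_natDegree_of_ne_zero hj).trans ?_), fun h0 => ?_⟩
  · exact Finset.le_sup (f := fun j => ((∑ i, a i • v i) j).natDegree) (Finset.mem_univ j)
  · rw [h0] at hj
    simp at hj

theorem linearIndependent_of_leading [Fintype ι] {v : ι → Fin N → F[X]} {e : ι → ℕ}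
    (hv : ∀ i j, (v i j).natDegree ≤ e i)
    (hlead : LinearIndependent F fun i j => (v i j).coeff (e i)) : LinearIndependent F[X] v := by
  rw [Fintype.linearIndependent_iff]
  intro a ha i
  by_contra h
  exact (natDegree_add_le_vecDegree_sum_smul hv hlead h).2 ha

theorem linearIndependent_toRat_iff {v : ι → Fin N → F[X]} :
    LinearIndependent (RatFunc F) (fun i => toRat (v i)) ↔ LinearIndependent F[X] v := by
  rw [← LinearIndependent.iff_fractionRing F[X] (RatFunc F)]
  refine LinearMap.linearIndependent_iff ((Algebra.linearMap F[X] (RatFunc F)).compLeft (Fin N))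
    (v := v) (LinearMap.ker_eq_bot.2 fun x y h => ?_)
  ext1 j
  exact IsFractionRing.injective F[X] (RatFunc F) (congrFun h j)

end PredictableDegree

/-! ### The rows form a minimal basis. -/

section RowBasis

variable {F : Type*} [Field F] {m N : ℕ}

theorem exists_perm_apply_ne_zero_of_det_ne_zero {R : Type*} [CommRing R]
    {ι : Type*} [Fintype ι] [DecidableEq ι] {A : Matrix ι ι R} (h : A.det ≠ 0) :
    ∃ σ : Equiv.Perm ι, ∀ i, A (σ i) i ≠ 0 := by
  rw [det_apply] at h
  obtain ⟨σ, -, hσ⟩ := Finset.exists_ne_zero_of_sum_ne_zero h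
  exact ⟨σ, fun i hi => hσ ((congrArg _ (Finset.prod_eq_zero (f := fun i => A (σ i) i)
    (Finset.mem_univ i) hi)).trans (smul_zero _))⟩

/-- Solve $Mx=y$ with $y_i=c_i\lambda^{d_i+k-1}$ and $\deg x<k$, then compare top coefficients. -/
theorem leadingRowwise_surjective {d : Fin m → ℕ} {M : Matrix (Fin m) (Fin N) F[X]}
    (hM : M ∈ rowBounded F N d) {k : ℕ} (hk : 1 ≤ k)
    (hs : Function.Surjective (trimmedSylvester d k M).mulVec) :
    Function.Surjective (leadingRowwise d M).mulVec := by
  intro c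
  obtain ⟨x, hx, hxy⟩ := (trimmedSylvester_surjective_iff hM k).1 hs
    (fun i => monomial (d i + (k - 1)) (c i)) fun i => mem_degreeLT.2
      ((degree_monomial_le _ _).trans_lt (by exact_mod_cast (by omega : d i + (k - 1) < k + d i)))
  refine ⟨fun j => (x j).coeff (k - 1), ?_⟩
  ext1 i
  have h1 := congrArg (fun p : F[X] => p.coeff (d i + (k - 1))) (congrFun hxy i)
  simp only [mulVec, dotProduct, finsetSum_coeff, coeff_monomial_same] at h1
  rw [← h1]
  simp only [mulVec, dotProduct]
  refine Finset.sum_congr rfl fun j _ => (coeff_mul_add_eq_of_natDegree_le (hM i j) ?_).symm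
  refine natDegree_le_iff_degree_le.2 (degree_le_of_natDegree_le ?_)
  rcases eq_or_ne (x j) 0 with h0 | h0
  · simp [h0]
  · have := (natDegree_lt_iff_degree_lt h0).2 (mem_degreeLT.1 (hx j))
    omega

theorem exists_polynomial_right_inverse {d : Fin m → ℕ} {M : Matrix (Fin m) (Fin N) F[X]}
    (hM : M ∈ rowBounded F N d) {k : ℕ} (hk : 1 ≤ k)
    (hs : Function.Surjective (trimmedSylvester d k M).mulVec) :
    ∃ G : Matrix (Fin N) (Fin m) F[X], M * G = 1 := by
  have h1 : ∀ l : Fin m, ∃ x : Fin N → F[X], M *ᵥ x = Pi.single l 1 := by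
    intro l
    obtain ⟨x, -, hx⟩ := (trimmedSylvester_surjective_iff hM k).1 hs (Pi.single l 1) fun i => by
      rw [Pi.single_apply]
      split_ifs
      · exact mem_degreeLT.2 (degree_one_le.trans_lt (by exact_mod_cast (by omega : 0 < k + d i)))
      · exact zero_mem _
    exact ⟨x, hx⟩
  choose x hx using h1
  refine ⟨Matrix.of fun j l => x l j, ?_⟩
  ext1 i l
  have := congrFun (hx l) i
  rw [one_apply, ← Pi.single_apply l (1 : F[X]) i, ← this]
  rfl

theorem vecDegree_eq_of_leadingRowwise_surjective {d : Fin m → ℕ}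
    {M : Matrix (Fin m) (Fin N) F[X]} (hM : M ∈ rowBounded F N d)
    (hl : Function.Surjective (leadingRowwise d M).mulVec) (i : Fin m) :
    vecDegree (M i) = d i := by
  refine le_antisymm (Finset.sup_le fun j _ => hM i j) ?_
  obtain ⟨x, hx⟩ := hl (Pi.single i 1)
  have hne : ∃ j, (M i j).coeff (d i) ≠ 0 := by
    by_contra! hcon
    have := congrFun hx i
    simp [mulVec, dotProduct, leadingRowwise, hcon] at this
  obtain ⟨j, hj⟩ := hne
  exact (le_natDegree_of_ne_zero hj).trans
    (Finset.le_sup (f := fun j => (M i j).natDegree) (Finset.mem_univ j))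

theorem linearIndependent_leadingRowwise {d : Fin m → ℕ} {M : Matrix (Fin m) (Fin N) F[X]}
    (hl : Function.Surjective (leadingRowwise d M).mulVec) :
    LinearIndependent F fun i j => (M i j).coeff (d i) := by
  obtain ⟨G, hG⟩ := mulVec_surjective_iff_exists_right_inverse.1 hl
  rw [Fintype.linearIndependent_iff]
  intro c hc
  have h1 : c ᵥ* leadingRowwise d M = 0 := by
    rw [vecMul_eq_sum]
    exact hc
  have h2 : c = 0 := by
    rw [← vecMul_one c, ← hG, ← vecMul_vecMul, h1, zero_vecMul]
  exact congrFun h2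

/-- Over the fraction field $W=CM$; multiplying by $G$ on the right shows that $C=WG$ is polynomial.
-/
theorem exists_mul_eq_of_mem_span {M : Matrix (Fin m) (Fin N) F[X]}
    {G : Matrix (Fin N) (Fin m) F[X]} (hG : M * G = 1) {r : ℕ} (W : Matrix (Fin r) (Fin N) F[X])
    (hW : ∀ i, toRat (W i) ∈ Submodule.span (RatFunc F) (Set.range fun i => toRat (M i))) :
    W * G * M = W := by
  choose c hc using fun i => (Submodule.mem_span_range_iff_exists_fun _).1 (hW i)
  let φ := algebraMap F[X] (RatFunc F)
  have h1 : W.map φ = Matrix.of c * M.map φ := by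
    ext1 i j
    rw [map_apply, mul_apply]
    simpa [toRat] using (congrFun (hc i) j).symm
  refine Matrix.map_injective (IsFractionRing.injective F[X] (RatFunc F)) ?_
  change (W * G * M).map φ = W.map φ
  rw [Matrix.map_mul, Matrix.map_mul, h1, Matrix.mul_assoc (Matrix.of c), ← Matrix.map_mul, hG,
    Matrix.map_one _ (map_zero _) (map_one _), Matrix.mul_one]

theorem isMinimalBasis_of_leadingRowwise_surjective {d : Fin m → ℕ}
    {M : Matrix (Fin m) (Fin N) F[X]} (hM : M ∈ rowBounded F N d)
    (hl : Function.Surjective (leadingRowwise d M).mulVec)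
    {G : Matrix (Fin N) (Fin m) F[X]} (hG : M * G = 1) : IsMinimalBasis M := by
  have hlead := linearIndependent_leadingRowwise hl
  refine ⟨⟨linearIndependent_toRat_iff.2 (linearIndependent_of_leading hM hlead), rfl⟩,
    fun w hw => ?_⟩
  have hA := exists_mul_eq_of_mem_span hG (Matrix.of w) fun i => by
    rw [← hw.span_eq]
    exact Submodule.subset_span ⟨i, rfl⟩
  have hdet : (Matrix.of w * G).det ≠ 0 := by
    intro h0
    obtain ⟨c, hc0, hc⟩ := exists_vecMul_eq_zero_iff.2 h0
    have h1 : c ᵥ* Matrix.of w = 0 := by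
      rw [← hA, ← vecMul_vecMul, hc, zero_vecMul]
    rw [vecMul_eq_sum] at h1
    exact hc0 (funext (Fintype.linearIndependent_iff.1
      (linearIndependent_toRat_iff.1 hw.linearIndependent) c h1))
  -- A nonzero term of the determinant pairs row $i$ of $M$ with a competitor $w_{\sigma(i)}$ that
  -- really involves it, so $\deg w_{\sigma(i)}\ge d_i$.
  obtain ⟨σ, hσ⟩ := exists_perm_apply_ne_zero_of_det_ne_zero hdet
  rw [← Equiv.sum_comp σ fun i => vecDegree (w i)]
  refine Finset.sum_le_sum fun i _ => ?_
  have h1 := (natDegree_add_le_vecDegree_sum_smul hM hlead (hσ i)).1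
  have h2 : ∑ l, (Matrix.of w * G) (σ i) l • M l = w (σ i) := by
    rw [← vecMul_eq_sum]
    exact congrFun hA (σ i)
  rw [h2] at h1
  rw [vecDegree_eq_of_leadingRowwise_surjective hM hl]
  omega

end RowBasis

/-! ### Kernel vectors of bounded degree and their leading coefficients. -/

section Kernel

variable {F : Type*} [Field F] {m N : ℕ}

/-- The polynomial vectors of degree less than `k` in the right null space of `M`. -/
noncomputable def kernelLT (M : Matrix (Fin m) (Fin N) F[X]) (k : ℕ) :
    Submodule F (Fin N → F[X]) where
  carrier := {x | (∀ j, x j ∈ degreeLT F k) ∧ M *ᵥ x = 0}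
  zero_mem' := ⟨fun _ => zero_mem _, mulVec_zero _⟩
  add_mem' := fun hx hy => ⟨fun j => add_mem (hx.1 j) (hy.1 j), by
    rw [mulVec_add, hx.2, hy.2, add_zero]⟩
  smul_mem' := fun c x hx => ⟨fun j => Submodule.smul_mem _ c (hx.1 j), by
    rw [mulVec_smul, hx.2, smul_zero]⟩

theorem mem_kernelLT {M : Matrix (Fin m) (Fin N) F[X]} {k : ℕ} {x : Fin N → F[X]} :
    x ∈ kernelLT M k ↔ (∀ j, x j ∈ degreeLT F k) ∧ M *ᵥ x = 0 := Iff.rfl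

theorem kernelLT_eq_map {d : Fin m → ℕ} {M : Matrix (Fin m) (Fin N) F[X]}
    (hM : M ∈ rowBounded F N d) (k : ℕ) :
    kernelLT M k =
      (LinearMap.ker (trimmedSylvester d k M).mulVecLin).map (ofCoeffs F N k) := by
  ext x
  rw [Submodule.mem_map, mem_kernelLT]
  constructor
  · rintro ⟨hx, h0⟩
    obtain ⟨c, rfl⟩ := exists_ofCoeffs_eq k x hx
    exact ⟨c, (trimmedSylvester_mulVec_eq_zero_iff hM k c).2 h0, rfl⟩
  · rintro ⟨c, hc, rfl⟩
    exact ⟨ofCoeffs_mem_degreeLT k c, (trimmedSylvester_mulVec_eq_zero_iff hM k c).1 hc⟩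

theorem finiteDimensional_kernelLT {d : Fin m → ℕ} {M : Matrix (Fin m) (Fin N) F[X]}
    (hM : M ∈ rowBounded F N d) (k : ℕ) : FiniteDimensional F (kernelLT M k) := by
  rw [kernelLT_eq_map hM]
  infer_instance

theorem finrank_kernelLT {n : ℕ} {d : Fin m → ℕ} {M : Matrix (Fin m) (Fin (m + n)) F[X]}
    (hM : M ∈ rowBounded F (m + n) d) {k : ℕ}
    (hs : Function.Surjective (trimmedSylvester d k M).mulVec) :
    Module.finrank F (kernelLT M k) + ∑ i, d i = n * k := by
  have h1 := rank_add_finrank_ker (trimmedSylvester d k M)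
  rw [(rank_eq_card_rows_iff _).2 hs, card_trimmedRow, Fintype.card_prod, Fintype.card_fin,
    Fintype.card_fin, mul_add] at h1
  rw [kernelLT_eq_map hM,
    ← (Submodule.equivMapOfInjective _ (ofCoeffs_injective k) _).finrank_eq]
  linarith [mul_comm k n]

theorem natDegree_le_of_mem_degreeLT_succ {p : F[X]} {k : ℕ} (h : p ∈ degreeLT F (k + 1)) :
    p.natDegree ≤ k := by
  rcases eq_or_ne p 0 with h0 | h0
  · simp [h0]
  · exact Nat.le_of_lt_succ ((natDegree_lt_iff_degree_lt h0).2 (mem_degreeLT.1 h))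

theorem mem_degreeLT_of_natDegree_lt {p : F[X]} {k : ℕ} (h : p.natDegree < k) :
    p ∈ degreeLT F k :=
  mem_degreeLT.2 (degree_le_natDegree.trans_lt (by exact_mod_cast h))

theorem toRat_mem_rightNullSpace_iff {M : Matrix (Fin m) (Fin N) F[X]} {x : Fin N → F[X]} :
    toRat x ∈ rightNullSpace M ↔ M *ᵥ x = 0 := by
  have h1 : M.map (algebraMap F[X] (RatFunc F)) *ᵥ toRat x = toRat (M *ᵥ x) := by
    ext1 i
    exact (RingHom.map_mulVec (algebraMap F[X] (RatFunc F)) M x i).symm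
  rw [rightNullSpace, LinearMap.mem_ker, mulVecLin_apply, h1]
  constructor
  · intro h
    ext1 i
    exact (IsFractionRing.injective F[X] (RatFunc F)) ((congrFun h i).trans (map_zero _).symm)
  · intro h
    rw [h]
    ext1 i
    exact map_zero _

theorem finrank_rightNullSpace {n : ℕ} {M : Matrix (Fin m) (Fin (m + n)) F[X]}
    (hM : LinearIndependent F[X] fun i => M i) :
    Module.finrank (RatFunc F) (rightNullSpace M) = n := by
  have h1 := rank_add_finrank_ker (M.map (algebraMap F[X] (RatFunc F)))
  have h2 : LinearIndependent (RatFunc F) (M.map (algebraMap F[X] (RatFunc F))).row :=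
    linearIndependent_toRat_iff.2 hM
  rw [h2.rank_matrix, Fintype.card_fin, Fintype.card_fin] at h1
  exact Nat.add_left_cancel h1

/-- The vector of coefficients of `λ^k` of a polynomial vector. -/
noncomputable def coeffVec (F : Type*) [Field F] (N k : ℕ) :
    (Fin N → F[X]) →ₗ[F] (Fin N → F) := (lcoeff F k).compLeft (Fin N)

theorem mem_kernelLT_of_coeffVec_eq_zero {M : Matrix (Fin m) (Fin N) F[X]} {k : ℕ}
    {x : Fin N → F[X]} (hx : x ∈ kernelLT M (k + 1)) (h : coeffVec F N k x = 0) :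
    x ∈ kernelLT M k := by
  refine ⟨fun j => mem_degreeLT.2 ((degree_lt_iff_coeff_zero _ _).2 fun b hb => ?_), hx.2⟩
  rcases hb.eq_or_lt with rfl | hb
  · exact congrFun h j
  · exact (degree_lt_iff_coeff_zero _ _).1 (mem_degreeLT.1 (hx.1 j)) b hb

theorem coeffVec_eq_zero_of_mem_kernelLT {M : Matrix (Fin m) (Fin N) F[X]} {k : ℕ}
    {x : Fin N → F[X]} (hx : x ∈ kernelLT M k) : coeffVec F N k x = 0 := by
  ext1 j
  exact (degree_lt_iff_coeff_zero _ _).1 (mem_degreeLT.1 (hx.1 j)) k le_rfl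

theorem kernelLT_mono (M : Matrix (Fin m) (Fin N) F[X]) {k l : ℕ} (h : k ≤ l) :
    kernelLT M k ≤ kernelLT M l :=
  fun _ hx => ⟨fun j => degreeLT_mono h (hx.1 j), hx.2⟩

/-- Rank-nullity: a vector of $K_{k+1}$ with zero coefficient of $\lambda^k$ lies in $K_k$. -/
theorem finrank_map_coeffVec_add {M : Matrix (Fin m) (Fin N) F[X]} (k : ℕ)
    [FiniteDimensional F (kernelLT M (k + 1))] :
    Module.finrank F ((kernelLT M (k + 1)).map (coeffVec F N k)) +
      Module.finrank F (kernelLT M k) = Module.finrank F (kernelLT M (k + 1)) := by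
  have h1 := LinearMap.finrank_range_add_finrank_ker
    ((coeffVec F N k).domRestrict (kernelLT M (k + 1)))
  have h2 : LinearMap.ker ((coeffVec F N k).domRestrict (kernelLT M (k + 1))) =
      (kernelLT M k).comap (kernelLT M (k + 1)).subtype := by
    ext x
    exact ⟨fun h => mem_kernelLT_of_coeffVec_eq_zero x.2 h,
      fun h => coeffVec_eq_zero_of_mem_kernelLT h⟩
  rwa [LinearMap.range_domRestrict, h2, (Submodule.comapSubtypeEquivOfLe
    (kernelLT_mono M (Nat.le_succ k))).finrank_eq] at h1

theorem X_smul_mem_kernelLT {M : Matrix (Fin m) (Fin N) F[X]} {k : ℕ} {x : Fin N → F[X]}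
    (hx : x ∈ kernelLT M k) : (X : F[X]) • x ∈ kernelLT M (k + 1) :=
  ⟨fun j => mul_mem_degreeLT natDegree_X_le (hx.1 j), by rw [mulVec_smul, hx.2, smul_zero]⟩

theorem coeffVec_succ_X_smul (k : ℕ) (x : Fin N → F[X]) :
    coeffVec F N (k + 1) ((X : F[X]) • x) = coeffVec F N k x := by
  ext1 j
  exact coeff_X_mul _ _

theorem linearIndependent_coeffVec_of_kernelLT_eq_bot {M : Matrix (Fin m) (Fin N) F[X]} {k : ℕ}
    (h0 : kernelLT M k = ⊥) {ι : Type*} {u : ι → Fin N → F[X]} (hu : LinearIndependent F u)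
    (hmem : ∀ i, u i ∈ kernelLT M (k + 1)) : LinearIndependent F (coeffVec F N k ∘ u) := by
  refine hu.map_injOn _ fun x hx y hy hxy => ?_
  have hle : Submodule.span F (Set.range u) ≤ kernelLT M (k + 1) :=
    Submodule.span_le.2 (by rintro _ ⟨i, rfl⟩; exact hmem i)
  have := mem_kernelLT_of_coeffVec_eq_zero (sub_mem (hle hx) (hle hy))
    (by rw [map_sub, hxy, sub_self])
  rw [h0, Submodule.mem_bot] at this
  exact sub_eq_zero.1 this

theorem kernelLT_eq_bot_of_injective {d : Fin m → ℕ} {M : Matrix (Fin m) (Fin N) F[X]}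
    (hM : M ∈ rowBounded F N d) {k : ℕ}
    (hi : Function.Injective (trimmedSylvester d k M).mulVec) : kernelLT M k = ⊥ :=
  (Submodule.eq_bot_iff _).2 fun x hx => (trimmedSylvester_injective_iff hM k).1 hi x hx.1 hx.2

/-- Existence of a family of solutions of degrees `k` and `k + 1` with independent leading
coefficient vectors, as many of degree `k` as possible. -/
theorem exists_leading_independent_family {M : Matrix (Fin m) (Fin N) F[X]} {k n t : ℕ}
    [FiniteDimensional F (kernelLT M (k + 1))] [FiniteDimensional F (kernelLT M (k + 2))]
    (h0 : kernelLT M k = ⊥) (h1 : Module.finrank F (kernelLT M (k + 1)) = t)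
    (h2 : Module.finrank F (kernelLT M (k + 2)) = n + t) :
    ∃ (v : Fin n → Fin N → F[X]) (e : Fin n → ℕ), (∀ i, M *ᵥ v i = 0) ∧
      (∀ i j, (v i j).natDegree ≤ e i) ∧
      (LinearIndependent F fun i j => (v i j).coeff (e i)) ∧ ∑ i, e i + t = n * (k + 1) := by
  classical
  let u := Module.finBasisOfFinrankEq F (kernelLT M (k + 1)) h1
  -- Shifting by $\lambda$ puts the solutions of degree $k$ into $K_{k+2}$ with the same leading
  -- vectors, so that all leading vectors can be compared at $\lambda^{k+1}$.
  let f : Fin t → Fin N → F[X] := fun i => (X : F[X]) • (u i : Fin N → F[X])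
  have hlead : LinearIndependent F (coeffVec F N (k + 1) ∘ f) := by
    have := linearIndependent_coeffVec_of_kernelLT_eq_bot h0
      (u.linearIndependent.map' (kernelLT M (k + 1)).subtype (Submodule.ker_subtype _))
      fun i => (u i).2
    convert this using 1
    ext1 i
    exact coeffVec_succ_X_smul k _
  have hf : Function.Injective f := hlead.injective.of_comp
  obtain ⟨b, hbK, hsb, hspan, hb⟩ := exists_linearIndepOn_extension
    ((linearIndepOn_range_iff hf _).2 hlead) (t := (kernelLT M (k + 2) : Set (Fin N → F[X])))
    (by rintro _ ⟨i, rfl⟩; exact X_smul_mem_kernelLT (u i).2)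
  have hb' : LinearIndependent F fun x : b => coeffVec F N (k + 1) x := hb
  have : Finite b := hb'.finite
  have := Fintype.ofFinite b
  have hcard : Fintype.card b = n := by
    have e1 := finrank_span_eq_card hb'
    have e2 : Submodule.span F (Set.range fun x : b => coeffVec F N (k + 1) x) =
        (kernelLT M (k + 2)).map (coeffVec F N (k + 1)) := by
      refine le_antisymm (Submodule.span_le.2 ?_) fun y hy => ?_
      · rintro _ ⟨x, rfl⟩
        exact Submodule.mem_map_of_mem (hbK x.2)
      · rw [← Set.image_eq_range]
        exact hspan hy
    have e3 := finrank_map_coeffVec_add (M := M) (k + 1)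
    rw [h1, h2, ← e2, e1] at e3
    omega
  -- The shifted members are divided by $\lambda$ again, which recovers the basis of $K_{k+1}$.
  let v : b → Fin N → F[X] := fun x =>
    if (x : Fin N → F[X]) ∈ Set.range f then fun j => divX (x.1 j) else x
  let e : b → ℕ := fun x => if (x : Fin N → F[X]) ∈ Set.range f then k else k + 1
  have hdiv (i : Fin t) : (fun j => divX (f i j)) = (u i : Fin N → F[X]) := by
    ext j c
    rw [coeff_divX]
    exact coeff_X_mul _ _
  have hv (x : b) : (M *ᵥ v x = 0 ∧ (∀ j, (v x j).natDegree ≤ e x)) ∧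
      (fun j => (v x j).coeff (e x)) = coeffVec F N (k + 1) x := by
    by_cases hx : (x : Fin N → F[X]) ∈ Set.range f
    · obtain ⟨i, hi⟩ := id hx
      have hvx : v x = u i := by
        simp only [v, if_pos hx, ← hi]
        exact hdiv i
      simp only [hvx, e, if_pos hx]
      rw [← hi]
      exact ⟨⟨(u i).2.2, fun j => natDegree_le_of_mem_degreeLT_succ ((u i).2.1 j)⟩,
        (coeffVec_succ_X_smul k _).symm⟩
    · simp only [v, e, if_neg hx]
      exact ⟨⟨(hbK x.2).2, fun j => natDegree_le_of_mem_degreeLT_succ ((hbK x.2).1 j)⟩, rfl⟩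
  have hsum : ∑ x, e x + t = n * (k + 1) := by
    have c1 : (Finset.univ.filter fun x : b => (x : Fin N → F[X]) ∈ Set.range f).card = t := by
      have : (Finset.univ.filter fun x : b => (x : Fin N → F[X]) ∈ Set.range f) =
          Finset.univ.image fun i : Fin t => (⟨f i, hsb ⟨i, rfl⟩⟩ : b) := by
        ext x
        simp [Subtype.ext_iff]
      rw [this, Finset.card_image_of_injective _ fun i j hij => hf (Subtype.ext_iff.1 hij),
        Finset.card_univ, Fintype.card_fin]
    conv_lhs => rw [← c1, Finset.card_filter, ← Finset.sum_add_distrib]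
    rw [Finset.sum_congr rfl (g := fun _ => k + 1) fun x _ => by
      simp only [e]; split_ifs <;> rfl]
    simp [hcard]
  let E : Fin n ≃ b := (Fintype.equivFinOfCardEq hcard).symm
  refine ⟨v ∘ E, e ∘ E, fun i => (hv (E i)).1.1, fun i => (hv (E i)).1.2, ?_, ?_⟩
  · have : (fun i j => ((v ∘ E) i j).coeff ((e ∘ E) i)) =
        (fun x : b => coeffVec F N (k + 1) x) ∘ E := by
      ext1 i
      exact (hv (E i)).2
    rw [this]
    exact hb'.comp _ E.injective
  · rw [← hsum, ← Equiv.sum_comp E e]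
    rfl

end Kernel

/-! ### Right minimal indices. -/

section MinimalIndices

variable {F : Type*} [Field F] {m N : ℕ}

theorem IsPolyBasis.card_eq {V : Submodule (RatFunc F) (Fin N → RatFunc F)} {r : ℕ}
    {v : Fin r → Fin N → F[X]} (h : IsPolyBasis V v) :
    r = Module.finrank (RatFunc F) V := by
  have := finrank_span_eq_card h.linearIndependent
  rw [h.span_eq, Fintype.card_fin] at this
  exact this.symm

theorem IsPolyBasis.mulVec_eq_zero {M : Matrix (Fin m) (Fin N) F[X]} {r : ℕ}
    {v : Fin r → Fin N → F[X]} (h : IsPolyBasis (rightNullSpace M) v) (i : Fin r) :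
    M *ᵥ v i = 0 := by
  rw [← toRat_mem_rightNullSpace_iff, ← h.span_eq]
  exact Submodule.subset_span ⟨i, rfl⟩

theorem mem_kernelLT_of_vecDegree_lt {M : Matrix (Fin m) (Fin N) F[X]} {x : Fin N → F[X]}
    (h : M *ᵥ x = 0) {k : ℕ} (hk : vecDegree x < k) : x ∈ kernelLT M k :=
  ⟨fun j => mem_degreeLT_of_natDegree_lt ((Finset.le_sup
    (f := fun j => (x j).natDegree) (Finset.mem_univ j)).trans_lt hk), h⟩

theorem IsPolyBasis.le_vecDegree {M : Matrix (Fin m) (Fin N) F[X]} {k : ℕ}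
    (h0 : kernelLT M k = ⊥) {r : ℕ} {v : Fin r → Fin N → F[X]}
    (h : IsPolyBasis (rightNullSpace M) v) (i : Fin r) : k ≤ vecDegree (v i) := by
  by_contra! hlt
  have := mem_kernelLT_of_vecDegree_lt (h.mulVec_eq_zero i) hlt
  rw [h0, Submodule.mem_bot] at this
  exact (linearIndependent_toRat_iff.1 h.linearIndependent).ne_zero i this

theorem IsPolyBasis.card_vecDegree_eq_le {M : Matrix (Fin m) (Fin N) F[X]} {k : ℕ}
    [FiniteDimensional F (kernelLT M (k + 1))] {r : ℕ} {v : Fin r → Fin N → F[X]}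
    (h : IsPolyBasis (rightNullSpace M) v) :
    (Finset.univ.filter fun i => vecDegree (v i) = k).card ≤
      Module.finrank F (kernelLT M (k + 1)) := by
  have h1 : LinearIndependent F v :=
    (linearIndependent_toRat_iff.1 h.linearIndependent).restrict_scalars
      (fun a b hab => by simpa [smul_eq_C_mul] using hab)
  let g : {i // vecDegree (v i) = k} → kernelLT M (k + 1) := fun i =>
    ⟨v i, mem_kernelLT_of_vecDegree_lt (h.mulVec_eq_zero i) (by rw [i.2]; exact Nat.lt_succ_self k)⟩
  have h2 : LinearIndependent F g :=
    LinearIndependent.of_comp (kernelLT M (k + 1)).subtype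
      (h1.comp (Subtype.val : {i // vecDegree (v i) = k} → Fin r) Subtype.val_injective)
  have h3 := h2.fintype_card_le_finrank
  rwa [Fintype.card_subtype] at h3

theorem isPolyBasis_rightNullSpace_of_leading {M : Matrix (Fin m) (Fin N) F[X]} {n : ℕ}
    (hV : Module.finrank (RatFunc F) (rightNullSpace M) = n) {v : Fin n → Fin N → F[X]}
    {e : Fin n → ℕ} (hMv : ∀ i, M *ᵥ v i = 0) (hv : ∀ i j, (v i j).natDegree ≤ e i)
    (hlead : LinearIndependent F fun i j => (v i j).coeff (e i)) :
    IsPolyBasis (rightNullSpace M) v := by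
  have h1 := linearIndependent_toRat_iff.2 (linearIndependent_of_leading hv hlead)
  refine ⟨h1, Submodule.eq_of_le_of_finrank_eq (Submodule.span_le.2 ?_) ?_⟩
  · rintro _ ⟨i, rfl⟩
    exact toRat_mem_rightNullSpace_iff.2 (hMv i)
  · rw [finrank_span_eq_card h1, hV, Fintype.card_fin]

/-- Termwise, with truncated subtraction: $e_i+[e_i=k]=(k+1)+(e_i-(k+1))$ whenever $e_i\ge k$. Hence
a bound on the number of indices equal to $k$ bounds the sum from below. -/
theorem sum_add_card_eq {ι : Type*} [Fintype ι] {e : ι → ℕ} {k : ℕ} (he : ∀ i, k ≤ e i) :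
    Fintype.card ι * (k + 1) + ∑ i, (e i - (k + 1)) =
      ∑ i, e i + (Finset.univ.filter fun i => e i = k).card := by
  rw [Finset.card_filter, ← Finset.sum_add_distrib, ← smul_eq_mul, ← Finset.card_univ,
    ← Finset.sum_const, ← Finset.sum_add_distrib]
  refine Finset.sum_congr rfl fun i _ => ?_
  have := he i
  split_ifs <;> omega

/-- The hypotheses force equality in that lower bound: exactly `t` values are $k$ and no value
exceeds $k+1$. -/
theorem map_val_eq_replicate_add {ι : Type*} [Fintype ι] {e : ι → ℕ} {k t : ℕ}
    (he : ∀ i, k ≤ e i) (ht : (Finset.univ.filter fun i => e i = k).card ≤ t)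
    (hsum : ∑ i, e i + t ≤ Fintype.card ι * (k + 1)) :
    (Finset.univ : Finset ι).val.map e =
      Multiset.replicate t k + Multiset.replicate (Fintype.card ι - t) (k + 1) := by
  have h1 := sum_add_card_eq he
  have h2 : (Finset.univ.filter fun i => e i = k).card = t := by omega
  have h3 : ∑ i, (e i - (k + 1)) = 0 := by omega
  have h4 : ∀ i, e i ≠ k → e i = k + 1 := fun i hi => by
    have := Finset.sum_eq_zero_iff.1 h3 i (Finset.mem_univ i)
    have := he i
    omega
  have h5 := Finset.card_filter_add_card_filter_not (s := (Finset.univ : Finset ι)) fun i => e i = k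
  rw [← Multiset.filter_add_not (fun i => e i = k) (Finset.univ : Finset ι).val, Multiset.map_add]
  congr 1
  · refine Multiset.eq_replicate.2 ⟨by rw [Multiset.card_map]; exact h2, fun b hb => ?_⟩
    obtain ⟨i, hi, rfl⟩ := Multiset.mem_map.1 hb
    exact (Multiset.mem_filter.1 hi).2
  · refine Multiset.eq_replicate.2 ⟨?_, fun b hb => ?_⟩
    · rw [Multiset.card_map, ← Finset.card_univ, ← h5, h2, Nat.add_sub_cancel_left]
      rfl
    · obtain ⟨i, hi, rfl⟩ := Multiset.mem_map.1 hb
      exact h4 i (Multiset.mem_filter.1 hi).2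

theorem sum_vecDegree_le_of_natDegree_le {r : ℕ} {v : Fin r → Fin N → F[X]} {e : Fin r → ℕ}
    (hv : ∀ i j, (v i j).natDegree ≤ e i) : ∑ i, vecDegree (v i) ≤ ∑ i, e i :=
  Finset.sum_le_sum fun i _ => Finset.sup_le fun j _ => hv i j

theorem hasRightMinimalIndices_of_surjective_of_injective {n t k : ℕ} {d : Fin m → ℕ}
    {M : Matrix (Fin m) (Fin (m + n)) F[X]} (hM : M ∈ rowBounded F (m + n) d)
    (hs : Function.Surjective (trimmedSylvester d (k + 1) M).mulVec)
    (hi : Function.Injective (trimmedSylvester d k M).mulVec)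
    (ht : n * (k + 1) = ∑ i, d i + t) :
    HasRightMinimalIndices M (Multiset.replicate t k + Multiset.replicate (n - t) (k + 1)) := by
  have hs' := trimmedSylvester_surjective_mono hM (by omega) (Nat.le_succ (k + 1)) hs
  have hK1 := finrank_kernelLT hM hs
  have hK2 : Module.finrank F (kernelLT M (k + 2)) + ∑ i, d i = n * (k + 2) :=
    finrank_kernelLT hM hs'
  have hf1 := finiteDimensional_kernelLT hM (k + 1)
  have hf2 := finiteDimensional_kernelLT hM (k + 2)
  have h0 := kernelLT_eq_bot_of_injective hM hi
  have h1 : Module.finrank F (kernelLT M (k + 1)) = t := by omega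
  have h2 : Module.finrank F (kernelLT M (k + 2)) = n + t := by
    have : n * (k + 2) = n * (k + 1) + n := by ring
    omega
  have hV := finrank_rightNullSpace (linearIndependent_of_leading hM
    (linearIndependent_leadingRowwise (leadingRowwise_surjective hM (by omega) hs)))
  obtain ⟨v, e, hMv, hve, hlead, hsum⟩ := exists_leading_independent_family h0 h1 h2
  have hv := isPolyBasis_rightNullSpace_of_leading hV hMv hve hlead
  have hdeg := sum_vecDegree_le_of_natDegree_le hve
  have hcard {r : ℕ} {w : Fin r → Fin (m + n) → F[X]}
      (hw : IsPolyBasis (rightNullSpace M) w) := hw.card_vecDegree_eq_le.trans_eq h1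
  refine ⟨⟨n, v, hv, fun w hw => ?_⟩, fun r w hw => ?_⟩
  · have a1 := sum_add_card_eq fun i => hw.le_vecDegree h0 i
    have a2 := hcard hw
    rw [Fintype.card_fin] at a1
    omega
  · obtain rfl : r = n := hw.isPolyBasis.card_eq.trans hV
    have a1 := hw.sum_le v hv
    have a2 := map_val_eq_replicate_add (fun i => hw.isPolyBasis.le_vecDegree h0 i)
      (hcard hw.isPolyBasis) (by rw [Fintype.card_fin]; omega)
    rwa [Fintype.card_fin] at a2

end MinimalIndices

end PolyMat

/-! ### Assembly of the theorem. -/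

theorem mainTheorem11 {𝕜 : Type*} [RCLike 𝕜] {m n : ℕ} (hn : 0 < n) (d : Fin m → ℕ)
    (hd : ∃ i, 0 < d i) (k' t : ℕ) (hk' : k' = ⌈((∑ i, d i : ℕ) : ℚ) / (n : ℚ)⌉₊)
    (ht : n * k' = ∑ i, d i + t) :
    (∀ M ∈ PolyMat.rowBounded 𝕜 (m + n) d, ∀ ε : ℝ, 0 < ε →
      ∃ M' ∈ PolyMat.TSyl 𝕜 (m + n) d, PolyMat.rho d M M' < ε) ∧
    (∀ M' ∈ PolyMat.TSyl 𝕜 (m + n) d,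
      (PolyMat.IsMinimalBasis M' ∧ (PolyMat.leadingRowwise d M').rank = m ∧
        ∀ i, PolyMat.vecDegree (M' i) = d i) ∧
      PolyMat.HasRightMinimalIndices M'
        (Multiset.replicate t (k' - 1) + Multiset.replicate (n - t) k')) ∧
    (∀ M' ∈ PolyMat.TSyl 𝕜 (m + n) d, ∃ ε : ℝ, 0 < ε ∧
      ∀ M ∈ PolyMat.rowBounded 𝕜 (m + n) d, PolyMat.rho d M M' < ε →
        M ∈ PolyMat.TSyl 𝕜 (m + n) d) := by
  obtain ⟨i₀, hi₀⟩ := hd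
  have hpos : 0 < ∑ i, d i := hi₀.trans_le (Finset.single_le_sum (fun _ _ => Nat.zero_le _)
    (Finset.mem_univ i₀))
  -- Not all $d_i$ vanish, so `k' - 1` is a genuine subtraction.
  have hk : k' ≠ 0 := by
    rintro rfl
    omega
  obtain ⟨k, rfl⟩ := Nat.exists_eq_succ_of_ne_zero hk
  have hhi : ∑ i, d i ≤ n * (k + 1) := (Nat.le_add_right _ t).trans ht.ge
  have hlo : n * k ≤ ∑ i, d i := by
    -- Minimality of the ceiling gives $n(k'-1)<\sum d_i$.
    have h1 : k < ⌈((∑ i, d i : ℕ) : ℚ) / (n : ℚ)⌉₊ := by omega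
    rw [Nat.lt_ceil, lt_div_iff₀ (by exact_mod_cast hn)] at h1
    have h2 : k * n < ∑ i, d i := by exact_mod_cast h1
    rw [mul_comm]
    exact h2.le
  have hT {M : Matrix (Fin m) (Fin (m + n)) 𝕜[X]} (hM : M ∈ PolyMat.rowBounded 𝕜 (m + n) d) :=
    PolyMat.fullTrimmedSylvesterRank_iff hM (k := k + 1) (by omega) hlo hhi
  refine ⟨fun M hM ε hε => ?_, fun M' hM' => ?_, fun M' hM' => ?_⟩
  · obtain ⟨M', hM', h, hρ⟩ := PolyMat.exists_rho_lt_surjective_and_injective hhi hlo hM hε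
    exact ⟨M', ⟨hM', (hT hM').2 h⟩, hρ⟩
  · obtain ⟨hM, hF⟩ := hM'
    obtain ⟨hs, hi⟩ := (hT hM).1 hF
    have hl := PolyMat.leadingRowwise_surjective hM (by omega) hs
    obtain ⟨G, hG⟩ := PolyMat.exists_polynomial_right_inverse hM (by omega) hs
    refine ⟨⟨PolyMat.isMinimalBasis_of_leadingRowwise_surjective hM hl hG, ?_,
      PolyMat.vecDegree_eq_of_leadingRowwise_surjective hM hl⟩,
      PolyMat.hasRightMinimalIndices_of_surjective_of_injective hM hs hi ht⟩
    rw [(PolyMat.rank_eq_card_rows_iff _).2 hl, Fintype.card_fin]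
  · obtain ⟨hM, hF⟩ := hM'
    obtain ⟨hs, hi⟩ := (hT hM).1 hF
    obtain ⟨ε₁, hε₁, h₁⟩ := PolyMat.exists_forall_rho_lt_mem hM _
      PolyMat.isOpen_setOf_mulVec_surjective hs
    obtain ⟨ε₂, hε₂, h₂⟩ := PolyMat.exists_forall_rho_lt_mem hM _
      PolyMat.isOpen_setOf_mulVec_injective hi
    refine ⟨min ε₁ ε₂, lt_min hε₁ hε₂, fun M hM hρ => ⟨hM, (hT hM).2 ⟨?_, ?_⟩⟩⟩
    · exact h₁ M hM (hρ.trans_le (min_le_left _ _))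
    · exact h₂ M hM (hρ.trans_le (min_le_right _ _))
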